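/- Let $\beta(q)$ be the sixth order mock theta function, defined as a formal power series (with integer coefficients) by $$\beta(q)=\sum_{n=0}^{\infty}\frac{q^{3n^2+3n+1}}{(q;q^3)_{n+1}\,(q^2;q^3)_{n+1}}=:\sum_{n=0}^{\infty}p_\beta(n)\,q^n,$$ where $(a;q)_m=\prod_{k=0}^{m-1}(1-aq^k)$. Then for every integer $n\ge 0$, $$p_\beta(15n+7)\equiv 0 \pmod 5,\qquad p_\beta(45n+23)\equiv 0 \pmod{15},\qquad p_\beta(45n+41)\equiv 0 \pmod{15}.$$ -/

import Mathlib

open scoped PowerSeries PowerSeries.WithPiTopology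

/-- The finite `q`-shifted factorial `(a; q)_n = ∏_{k=0}^{n-1} (1 - a q^k)` in a commutative ring. -/
def qShiftedFactorial {R : Type*} [CommRing R] (a q : R) (n : ℕ) : R :=
  ∏ k ∈ Finset.range n, (1 - a * q ^ k)

/-- The denominator `(q; q^3)_{n+1} (q^2; q^3)_{n+1}` of the `n`-th summand of `β(q)`,
as a formal power series in `q = X`. -/
noncomputable def betaDenominator (n : ℕ) : ℤ⟦X⟧ :=
  qShiftedFactorial (PowerSeries.X : ℤ⟦X⟧) (PowerSeries.X ^ 3) (n + 1) *
    qShiftedFactorial ((PowerSeries.X : ℤ⟦X⟧) ^ 2) (PowerSeries.X ^ 3) (n + 1)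

/-- The `n`-th summand `q^(3n^2+3n+1) / ((q; q^3)_{n+1} (q^2; q^3)_{n+1})` of `β(q)`.
The denominator has constant coefficient `1`, so it is invertible over `ℤ`. -/
noncomputable def betaSummand (n : ℕ) : ℤ⟦X⟧ :=
  PowerSeries.X ^ (3 * n ^ 2 + 3 * n + 1) * PowerSeries.invOfUnit (betaDenominator n) 1

/-- The sixth order mock theta function `β(q)` as a formal power series: the sum of the summands
in the topology of coefficientwise convergence. -/
noncomputable def mockThetaBeta : ℤ⟦X⟧ :=
  ∑' n : ℕ, betaSummand n

/-- `p_β(n)`, the coefficient of `q^n` in `β(q)`. -/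
noncomputable def pBeta (n : ℕ) : ℤ :=
  PowerSeries.coeff n mockThetaBeta

/-- The constant coefficient of the denominator is `1`. -/
theorem constantCoeff_betaDenominator (n : ℕ) :
    PowerSeries.constantCoeff (betaDenominator n) = 1 := by
  simp [betaDenominator, qShiftedFactorial, map_prod]

/-- The inverse in `betaSummand` is a genuine inverse. -/
theorem betaSummand_mul_betaDenominator (n : ℕ) :
    betaSummand n * betaDenominator n = PowerSeries.X ^ (3 * n ^ 2 + 3 * n + 1) := by
  have h : betaDenominator n * PowerSeries.invOfUnit (betaDenominator n) 1 = 1 :=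
    PowerSeries.mul_invOfUnit _ _ (by simp [constantCoeff_betaDenominator])
  rw [betaSummand, mul_assoc, mul_comm _ (betaDenominator n), h, mul_one]

/-- The series defining `β(q)` converges, so the infinite sum is a genuine one. -/
theorem summable_betaSummand : Summable betaSummand := by
  rw [PowerSeries.WithPiTopology.summable_iff_summable_coeff]
  intro d
  refine summable_of_ne_finset_zero (s := Finset.range (d + 1)) fun n hn => ?_
  have hd : d < 3 * n ^ 2 + 3 * n + 1 := by
    have : d + 1 ≤ n := by simpa using hn
    nlinarith [sq_nonneg n]
  rw [betaSummand, PowerSeries.coeff_X_pow_mul', if_neg (by omega)]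

/-! Write E(q) for the Euler product ∏ (1 - q^n). The congruences follow from two product formulas:
the generating function of p_β(3n+1) is E(q³)³ / E(q)² (`dissect_one_beta`), and that of p_β(9n+5)
is 3 E(q³)⁶ / E(q)⁵ (`dissect_five_beta`).

The factor 3 is visible in the second formula. Modulo 5, E(q)⁵ ≡ E(q⁵) removes the denominators. In
the first formula this leaves E(q)³ E(q³)³. By Jacobi's identity E³ has exponents 0, 1 mod 5 only,
so the residue 2 never occurs. In the second it leaves E(q³) times a series in q⁵, and pentagonal
numbers are 0, 1, 2 mod 5, so the residues 2 and 4 never occur.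

For the product formulas, Bailey's lemma (`hasSum_bailey`) turns β into a bilateral sum: E(q³) β(q)
= q ∑ (-1)^k q^(9k(k+1)/2) / (1 - q^(3k+1)). Since 1/(1-x) = (1+x+x²)/(1-x³), this splits by
exponents mod 3 into the sums A_b = `appell b`, taken at q³. The classes 1 and 2 of β are therefore
A_0/E and A_1/E. Letting n → ∞ in a partial fraction expansion gives A_0 E = E(q³)³, which is the
first formula.

A_1 is not a product, but its own class is accessible. Inserting a variable z and comparing
first-order recurrences of z-coefficients shows that q E(q³)³ A_1 / E equals ∑ k q^k / (1 - q^(3k))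
up to a series in q³ (`exists_cube_euler_cubed_mul_appell`). Taking exponents 2 mod 3 discards the
unknown series and leaves ∑ (3m+2) q^m / (1 - q^(3m+2)). This equals 3 A_0² (`lambert_two`), as one
sees by squaring A_0 = ∑ q^k / (1 - q^(3k+1)). -/

open Filter Topology WithZero
open scoped LaurentSeries

namespace MockBeta

/-! ### Laurent series: divisibility by powers of q and convergence -/

/-- The field of formal Laurent series in `q` over `ℚ`. -/
abbrev K : Type := LaurentSeries ℚ

/-- The variable of the field of Laurent series. -/
noncomputable def q : K := HahnSeries.single 1 1

/-- `OrdGE D f` says that `f` is divisible by `q ^ D`. -/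
def OrdGE (D : ℤ) (f : K) : Prop := Valued.v f ≤ exp (-D)

theorem ordGE_iff {D : ℤ} {f : K} : OrdGE D f ↔ ∀ n < D, f.coeff n = 0 :=
  LaurentSeries.valuation_le_iff_coeff_lt_eq_zero ℚ

theorem q_zpow (n : ℤ) : q ^ n = HahnSeries.single n (1 : ℚ) := by
  rw [q, ← RatFunc.single_zpow]

theorem q_ne_zero : q ≠ 0 := by
  rw [q]; simp

theorem v_q_zpow (n : ℤ) : Valued.v (q ^ n) = exp (-n) := by
  rw [q_zpow]; exact LaurentSeries.valuation_single_zpow ℚ n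

theorem ordGE_q_zpow {n D : ℤ} (h : D ≤ n) : OrdGE D (q ^ n) := by
  rw [OrdGE, v_q_zpow]; exact exp_le_exp.2 (by omega)

theorem OrdGE.mono {D D' : ℤ} {f : K} (hf : OrdGE D f) (h : D' ≤ D) : OrdGE D' f :=
  le_trans hf (exp_le_exp.2 (by omega))

theorem OrdGE.mul {D D' : ℤ} {f g : K} (hf : OrdGE D f) (hg : OrdGE D' g) :
    OrdGE (D + D') (f * g) := by
  unfold OrdGE at *
  rw [map_mul, neg_add, exp_add]
  exact mul_le_mul' hf hg

theorem OrdGE.mul_left {D : ℤ} {f g : K} (hf : OrdGE 0 f) (hg : OrdGE D g) :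
    OrdGE D (f * g) := by
  simpa using hf.mul hg

theorem OrdGE.mul_right {D : ℤ} {f g : K} (hf : OrdGE D f) (hg : OrdGE 0 g) :
    OrdGE D (f * g) := by
  simpa using hf.mul hg

theorem OrdGE.add {D : ℤ} {f g : K} (hf : OrdGE D f) (hg : OrdGE D g) : OrdGE D (f + g) :=
  Valuation.map_add_le _ hf hg

theorem OrdGE.sub {D : ℤ} {f g : K} (hf : OrdGE D f) (hg : OrdGE D g) : OrdGE D (f - g) :=
  Valuation.map_sub_le (v := Valued.v) hf hg

theorem OrdGE.neg {D : ℤ} {f : K} (hf : OrdGE D f) : OrdGE D (-f) := by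
  unfold OrdGE at *; rwa [Valuation.map_neg]

theorem ordGE_zero (D : ℤ) : OrdGE D 0 := by simp [OrdGE]

theorem ordGE_one : OrdGE 0 (1 : K) := by simp [OrdGE]

theorem OrdGE.pow {f : K} (hf : OrdGE 0 f) (n : ℕ) : OrdGE 0 (f ^ n) := by
  induction n with
  | zero => simpa using ordGE_one
  | succ n ih => rw [pow_succ]; exact ih.mul_left hf

theorem ordGE_intCast (n : ℤ) : OrdGE 0 (n : K) := by
  rw [ordGE_iff]
  intro m hm
  rw [show (n : K) = HahnSeries.single 0 (n : ℚ) from (map_intCast (HahnSeries.C (Γ := ℤ)) n).symm]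
  exact HahnSeries.coeff_single_of_ne hm.ne

theorem ordGE_natCast (n : ℕ) : OrdGE 0 (n : K) := mod_cast ordGE_intCast n

theorem ordGE_neg_one_zpow (n : ℤ) : OrdGE 0 ((-1 : K) ^ n) := by
  rcases Int.even_or_odd n with h | h
  · rw [h.neg_one_zpow]; exact ordGE_one
  · rw [h.neg_one_zpow]; exact ordGE_one.neg

theorem ordGE_sum {ι : Type*} {D : ℤ} {f : ι → K} (s : Finset ι) (h : ∀ i ∈ s, OrdGE D (f i)) :
    OrdGE D (∑ i ∈ s, f i) :=
  Valuation.map_sum_le _ h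

theorem eq_zero_of_ordGE {f : K} (h : ∀ D : ℕ, OrdGE D f) : f = 0 := by
  ext n
  exact ordGE_iff.1 (h (n.toNat + 1)) n (by omega)

theorem hasBasis_nhds_zero : (𝓝 (0 : K)).HasBasis (fun _ : ℤ => True) fun D => {f | OrdGE D f} := by
  refine ⟨fun s => ?_⟩
  rw [Valued.mem_nhds_zero]
  constructor
  · rintro ⟨γ, hγ⟩
    set e := MonoidWithZeroHom.ValueGroup₀.embedding γ.1 with he
    have hne : e ≠ 0 := by simp [he]
    refine ⟨1 - log e, trivial, fun f hf => hγ ?_⟩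
    rw [Set.mem_ofPred_eq, Valuation.restrict_lt_iff_lt_embedding, ← he, ← exp_log hne]
    exact lt_of_le_of_lt hf (exp_lt_exp.2 (by omega))
  · rintro ⟨D, -, hD⟩
    have hne : Valued.v.restrict (q ^ (D - 1)) ≠ 0 := by
      simp [q_ne_zero, zpow_ne_zero]
    refine ⟨Units.mk0 _ hne, fun f hf => hD ?_⟩
    rw [Set.mem_ofPred_eq, Units.val_mk0, Valuation.restrict_lt_iff, v_q_zpow] at hf
    rw [show -(D - 1) = -D + 1 by ring, exp_add] at hf
    exact (lt_mul_exp_iff_le exp_ne_zero).1 hf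

theorem tendsto_iff_ordGE {ι : Type*} {l : Filter ι} {f : ι → K} {a : K} :
    Tendsto f l (𝓝 a) ↔ ∀ D : ℤ, ∀ᶠ i in l, OrdGE D (f i - a) := by
  rw [← tendsto_sub_nhds_zero_iff, hasBasis_nhds_zero.tendsto_right_iff]
  simp

/-- The additive subgroup of all series divisible by `q ^ D`. -/
def ordSubgroup (D : ℤ) : AddSubgroup K where
  carrier := {f | OrdGE D f}
  add_mem' := OrdGE.add
  zero_mem' := ordGE_zero D
  neg_mem' := OrdGE.neg

theorem isOpen_ordSubgroup (D : ℤ) : IsOpen (ordSubgroup D : Set K) :=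
  AddSubgroup.isOpen_of_mem_nhds (g := 0) _ (hasBasis_nhds_zero.mem_of_mem trivial)

/-- With this, a family is summable as soon as its terms tend to zero, and products of convergent
sums may be expanded as double sums; every later rearrangement rests on it. -/
instance : NonarchimedeanRing K where
  is_nonarchimedean U hU := by
    obtain ⟨D, -, hD⟩ := hasBasis_nhds_zero.mem_iff.1 hU
    exact ⟨⟨ordSubgroup D, isOpen_ordSubgroup D⟩, hD⟩

theorem summable_of_ordGE {ι : Type*} {f : ι → K} (e : ι → ℤ) (he : ∀ D, {i | e i < D}.Finite)
    (h : ∀ i, OrdGE (e i) (f i)) : Summable f := by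
  apply NonarchimedeanAddGroup.summable_of_tendsto_cofinite_zero
  rw [hasBasis_nhds_zero.tendsto_right_iff]
  intro D _
  refine (he D).subset fun i hi => ?_
  by_contra hlt
  exact hi ((h i).mono (not_lt.1 hlt))

theorem finite_natCast_lt (D : ℤ) : {n : ℕ | (n : ℤ) < D}.Finite :=
  (Set.finite_Iio D.toNat).subset fun n hn => by
    simp only [Set.mem_ofPred_eq, Set.mem_Iio] at *; omega

theorem finite_abs_lt (D : ℤ) : {n : ℤ | |n| < D}.Finite :=
  (Set.finite_Ioo (-D) D).subset fun _ hn => abs_lt.1 hn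

theorem finite_abs_add_abs_lt (D : ℤ) : {n : ℤ × ℤ | |n.1| + |n.2| < D}.Finite :=
  ((finite_abs_lt D).prod (finite_abs_lt D)).subset fun n hn => by
    have h1 := abs_nonneg n.1
    have h2 := abs_nonneg n.2
    simp only [Set.mem_ofPred_eq, Set.mem_prod] at *
    constructor <;> omega

theorem finite_natCast_add_natCast_lt (D : ℤ) : {n : ℕ × ℕ | (n.1 : ℤ) + n.2 < D}.Finite :=
  ((finite_natCast_lt D).prod (finite_natCast_lt D)).subset fun n hn => by
    simp only [Set.mem_ofPred_eq, Set.mem_prod] at *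
    constructor <;> omega

theorem OrdGE.of_hasSum {ι : Type*} {D : ℤ} {f : ι → K} {a : K} (ha : HasSum f a)
    (h : ∀ i, OrdGE D (f i)) : OrdGE D a :=
  ((ordSubgroup D).isClosed_of_isOpen (isOpen_ordSubgroup D)).mem_of_tendsto ha
    (Eventually.of_forall fun s => ordGE_sum s fun i _ => h i)

theorem OrdGE.of_tendsto {D : ℤ} {f : ℕ → K} {a : K} (ha : Tendsto f atTop (𝓝 a))
    (h : ∀ i, OrdGE D (f i)) : OrdGE D a :=
  ((ordSubgroup D).isClosed_of_isOpen (isOpen_ordSubgroup D)).mem_of_tendsto ha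
    (Eventually.of_forall h)

theorem ordGE_tsum {ι : Type*} {D : ℤ} {f : ι → K} (h : ∀ i, OrdGE D (f i)) :
    OrdGE D (∑' i, f i) := by
  by_cases hf : Summable f
  · exact .of_hasSum hf.hasSum h
  · rw [tsum_eq_zero_of_not_summable hf]; exact ordGE_zero D

/-- Tannery's theorem for formal Laurent series. -/
theorem tendsto_tsum_of_ordGE {ι : Type*} {F : ℕ → ι → K} {G : ι → K} (e : ι → ℤ)
    (he : ∀ D, {i | e i < D}.Finite) (h : ∀ n i, OrdGE (e i) (F n i))
    (hF : ∀ i, Tendsto (F · i) atTop (𝓝 (G i))) :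
    Tendsto (fun n => ∑' i, F n i) atTop (𝓝 (∑' i, G i)) := by
  have hG (i) : OrdGE (e i) (G i) := .of_tendsto (hF i) fun n => h n i
  rw [tendsto_iff_ordGE]
  intro D
  have hev : ∀ᶠ n in atTop, ∀ i ∈ (he D).toFinset, OrdGE D (F n i - G i) :=
    (eventually_all_finset _).2 fun i _ => tendsto_iff_ordGE.1 (hF i) D
  filter_upwards [hev] with n hn
  rw [← (summable_of_ordGE e he (h n)).tsum_sub (summable_of_ordGE e he hG)]
  refine ordGE_tsum fun i => ?_
  by_cases hi : e i < D
  · exact hn i (by simpa using hi)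
  · exact ((h n i).sub (hG i)).mono (not_lt.1 hi)

/-! ### Integral power series as Laurent series, and the substitution q ↦ q³ -/

/-- The embedding of integral power series into the field of Laurent series. -/
noncomputable def toK : ℤ⟦X⟧ →+* K :=
  (HahnSeries.ofPowerSeries ℤ ℚ).comp (PowerSeries.map (Int.castRingHom ℚ))

theorem coeff_toK_natCast (f : ℤ⟦X⟧) (n : ℕ) :
    (toK f).coeff (n : ℤ) = ((PowerSeries.coeff n f : ℤ) : ℚ) := by
  refine (HahnSeries.ofPowerSeries_apply_coeff _ n).trans ?_
  simp

theorem coeff_toK_of_neg (f : ℤ⟦X⟧) {n : ℤ} (hn : n < 0) : (toK f).coeff n = 0 := by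
  have := PowerSeries.coeff_coe (PowerSeries.map (Int.castRingHom ℚ) f) n
  rwa [if_pos hn] at this

theorem ordGE_toK {f : ℤ⟦X⟧} {D : ℕ} (h : ∀ n < D, PowerSeries.coeff n f = 0) :
    OrdGE D (toK f) := by
  rw [ordGE_iff]
  intro n hn
  rcases lt_or_ge n 0 with h0 | h0
  · exact coeff_toK_of_neg f h0
  · lift n to ℕ using h0
    rw [coeff_toK_natCast, h n (by omega), Int.cast_zero]

theorem toK_injective : Function.Injective toK := fun f g h => by
  ext n
  have := congr_arg (fun x : K => x.coeff (n : ℤ)) h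
  simpa only [coeff_toK_natCast, Int.cast_inj] using this

theorem toK_X : toK PowerSeries.X = q := by
  simp [toK, q]

theorem continuous_toK : Continuous toK := by
  refine continuous_of_continuousAt_zero toK ?_
  rw [ContinuousAt, map_zero, tendsto_iff_ordGE]
  intro D
  have h (n : ℕ) : ∀ᶠ f in 𝓝 (0 : ℤ⟦X⟧), PowerSeries.coeff n f = 0 := by
    have := (PowerSeries.WithPiTopology.continuous_coeff ℤ n).tendsto 0
    rw [map_zero, nhds_discrete ℤ] at this
    exact this (Set.mem_singleton _)
  filter_upwards [(eventually_all_finset (Finset.range D.toNat)).2 fun n _ => h n] with f hf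
  rw [sub_zero]
  exact (ordGE_toK (D := D.toNat) fun n hn => hf n (by simpa using hn)).mono (by omega)

/-- Multiplication by three as an order embedding of the integers. -/
noncomputable def threeMulEmb : ℤ ↪o ℤ :=
  OrderEmbedding.ofStrictMono (fun n => 3 * n) fun _ _ h => by simpa using h

/-- The endomorphism `q ↦ q ^ 3`. -/
noncomputable def cube : K →+* K :=
  HahnSeries.embDomainRingHom (AddMonoidHom.mulLeft (3 : ℤ))
    threeMulEmb.injective fun _ _ => threeMulEmb.le_iff_le

theorem cube_apply (f : K) : cube f = HahnSeries.embDomain threeMulEmb f := rfl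

theorem coeff_cube_three_mul (f : K) (n : ℤ) : (cube f).coeff (3 * n) = f.coeff n :=
  HahnSeries.embDomain_coeff (f := threeMulEmb)

theorem coeff_cube_of_not_dvd (f : K) {n : ℤ} (h : ¬ 3 ∣ n) : (cube f).coeff n = 0 :=
  HahnSeries.embDomain_of_notMem_range fun ⟨m, hm⟩ => h ⟨m, hm.symm⟩

theorem cube_q : cube q = q ^ 3 := by
  have h := q_zpow 3
  rw [zpow_ofNat] at h
  rw [h, q, cube_apply, HahnSeries.embDomain_single]
  rfl

theorem cube_q_zpow (n : ℤ) : cube (q ^ n) = q ^ (3 * n) := by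
  rw [map_zpow₀, cube_q, zpow_mul]; norm_cast

theorem OrdGE.cube {D : ℤ} {f : K} (h : OrdGE D f) : OrdGE (3 * D) (cube f) := by
  rw [ordGE_iff] at *
  intro n hn
  by_cases h3 : 3 ∣ n
  · obtain ⟨m, rfl⟩ := h3
    rw [coeff_cube_three_mul, h m (by omega)]
  · exact coeff_cube_of_not_dvd f h3

theorem continuous_cube : Continuous cube := by
  refine continuous_of_continuousAt_zero cube ?_
  rw [ContinuousAt, map_zero, tendsto_iff_ordGE]
  intro D
  filter_upwards [tendsto_iff_ordGE.1 (tendsto_id (x := 𝓝 (0 : K))) |D|] with f hf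
  rw [sub_zero] at *
  exact hf.cube.mono (by have := le_abs_self D; have := abs_nonneg D; omega)

theorem cube_toK (f : ℤ⟦X⟧) : cube (toK f) = toK (PowerSeries.expand 3 three_ne_zero f) := by
  ext n
  rcases lt_or_ge n 0 with h0 | h0
  · rw [coeff_toK_of_neg _ h0]
    by_cases h3 : 3 ∣ n
    · obtain ⟨m, rfl⟩ := h3
      rw [coeff_cube_three_mul, coeff_toK_of_neg _ (by omega)]
    · exact coeff_cube_of_not_dvd _ h3
  · lift n to ℕ using h0
    rw [coeff_toK_natCast, PowerSeries.coeff_expand]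
    split_ifs with h3
    · obtain ⟨m, rfl⟩ := h3
      rw [Nat.cast_mul, Nat.cast_ofNat, coeff_cube_three_mul, coeff_toK_natCast]
      simp
    · rw [coeff_cube_of_not_dvd _ (by omega), Int.cast_zero]

theorem coeff_q_zpow_mul (i n : ℤ) (f : K) : (q ^ i * f).coeff n = f.coeff (n - i) := by
  have := HahnSeries.coeff_single_mul_add (r := (1 : ℚ)) (x := f) (a := n - i) (b := i)
  rwa [← q_zpow, sub_add_cancel, one_mul] at this

/-- The three summands have exponents in different residue classes modulo 3, so nothing can cancel
between them. -/
theorem eq_zero_of_dissection {a b c : K} (h : cube a + q * cube b + q ^ 2 * cube c = 0) :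
    a = 0 ∧ b = 0 ∧ c = 0 := by
  have key (n : ℤ) : (cube a).coeff n + (cube b).coeff (n - 1) + (cube c).coeff (n - 2) = 0 := by
    have := congr_arg (fun x : K => x.coeff n) h
    have h1 := coeff_q_zpow_mul 1 n (cube b)
    have h2 := coeff_q_zpow_mul 2 n (cube c)
    rw [zpow_one] at h1
    rw [zpow_ofNat] at h2
    simpa only [HahnSeries.coeff_add, h1, h2, HahnSeries.coeff_zero] using this
  refine ⟨?_, ?_, ?_⟩ <;> ext n
  · have := key (3 * n)
    rw [coeff_cube_three_mul, coeff_cube_of_not_dvd b (by omega),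
      coeff_cube_of_not_dvd c (by omega)] at this
    simpa using this
  · have := key (3 * n + 1)
    rw [coeff_cube_of_not_dvd a (by omega), coeff_cube_of_not_dvd c (by omega),
      show 3 * n + 1 - 1 = 3 * n by ring, coeff_cube_three_mul] at this
    simpa using this
  · have := key (3 * n + 2)
    rw [coeff_cube_of_not_dvd a (by omega), coeff_cube_of_not_dvd b (by omega),
      show 3 * n + 2 - 2 = 3 * n by ring, coeff_cube_three_mul] at this
    simpa using this

/-! ### Triangular numbers -/

/-- The triangular numbers, extended to the integers. -/
def tri (x : ℤ) : ℤ := x * (x + 1) / 2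

theorem two_mul_tri (x : ℤ) : 2 * tri x = x * (x + 1) :=
  Int.two_mul_ediv_two_of_even (Int.even_mul_succ_self x)

theorem tri_add_one (x : ℤ) : tri (x + 1) = tri x + (x + 1) := by
  have h1 := two_mul_tri x
  have h2 := two_mul_tri (x + 1)
  linarith

theorem tri_sub_one (x : ℤ) : tri (x - 1) = tri x - x := by
  have h1 := two_mul_tri x
  have h2 := two_mul_tri (x - 1)
  linarith

theorem tri_reflect (x : ℤ) : tri (-1 - x) = tri x := by
  have h1 := two_mul_tri x
  have h2 := two_mul_tri (-1 - x)
  linarith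

theorem tri_zero : tri 0 = 0 := rfl

theorem self_le_tri {x : ℤ} : x ≤ tri x := by
  have h1 := two_mul_tri x
  have : 0 ≤ x * (x - 1) := by
    rcases le_or_gt x 0 with h | h
    · exact mul_nonneg_of_nonpos_of_nonpos h (by omega)
    · exact mul_nonneg h.le (by omega)
  linarith

theorem tri_nonneg (x : ℤ) : 0 ≤ tri x := by
  rcases le_or_gt 0 x with h | h
  · exact h.trans self_le_tri
  · rw [← tri_reflect]; exact le_trans (by omega) self_le_tri

theorem abs_le_tri_add_one (x : ℤ) : |x| ≤ tri x + 1 := by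
  rcases le_or_gt 0 x with h | h
  · rw [abs_of_nonneg h]; linarith [self_le_tri (x := x)]
  · rw [abs_of_neg h, ← tri_reflect]; linarith [self_le_tri (x := -1 - x)]

/-! ### Finite q-series identities over a field -/

section Finite

variable {F : Type*} [Field F]

/-- The product `(t; t)_n`. -/
def poch (t : F) (n : ℕ) : F := ∏ k ∈ Finset.range n, (1 - t ^ (k + 1))

/-- The reciprocal of `(t; t)_m`, which vanishes for negative `m`. -/
def pochInv (t : F) (m : ℤ) : F := if 0 ≤ m then (poch t m.toNat)⁻¹ else 0

theorem poch_ne_zero {t : F} (h1 : ∀ k : ℕ, t ^ (k + 1) ≠ 1) (n : ℕ) : poch t n ≠ 0 :=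
  Finset.prod_ne_zero_iff.2 fun k _ => sub_ne_zero.2 (h1 k).symm

theorem pochInv_natCast (t : F) (n : ℕ) : pochInv t n = (poch t n)⁻¹ := by
  simp [pochInv]

theorem pochInv_of_neg (t : F) {m : ℤ} (hm : m < 0) : pochInv t m = 0 :=
  if_neg (not_le.2 hm)

theorem pochInv_zero (t : F) : pochInv t 0 = 1 := by
  simp [pochInv, poch]

theorem pochInv_sub_one {t : F} (h1 : ∀ k : ℕ, t ^ (k + 1) ≠ 1) (m : ℤ) :
    pochInv t (m - 1) = (1 - t ^ m) * pochInv t m := by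
  rcases lt_trichotomy m 0 with h | rfl | h
  · rw [pochInv_of_neg t h, pochInv_of_neg t (by omega), mul_zero]
  · rw [pochInv_of_neg t (by omega)]; simp
  · obtain ⟨k, rfl⟩ : ∃ k : ℕ, m = k + 1 := ⟨(m - 1).toNat, by omega⟩
    have h2 : (1 : F) - t ^ (k + 1) ≠ 0 := sub_ne_zero.2 (h1 k).symm
    rw [add_sub_cancel_right, pochInv_natCast, ← Nat.cast_succ, pochInv_natCast, zpow_natCast,
      Nat.succ_eq_add_one, poch, poch, Finset.prod_range_succ, mul_inv, mul_left_comm,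
      mul_inv_cancel₀ h2, mul_one]

/-- After multiplication by 1 - t^n the sum telescopes. For 0 ≤ n < N the right side contains the
reciprocal factorial of a negative index, so the full sum vanishes unless n = 0: the unit Bailey
pair. -/
theorem one_sub_mul_sum_unit_bailey {t : F} (ht : t ≠ 0) (h1 : ∀ k : ℕ, t ^ (k + 1) ≠ 1) (n : ℤ)
    (N : ℕ) :
    (1 - t ^ n) * ∑ r ∈ Finset.range N, (-1) ^ r * t ^ (tri r - r) * (1 - t ^ (2 * r + 1)) *
      (pochInv t (n - r) * pochInv t (n + r + 1)) =
    -((-1) ^ N * t ^ (tri N - N) * (1 - t ^ N) * (pochInv t (n - N) * pochInv t (n + N))) := by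
  induction N with
  | zero => simp
  | succ N ih =>
    rw [Finset.sum_range_succ, mul_add, ih]
    have e1 := pochInv_sub_one h1 (n - N)
    have e2 := pochInv_sub_one h1 (n + N + 1)
    rw [add_sub_cancel_right] at e2
    rw [show n - ((N + 1 : ℕ) : ℤ) = n - N - 1 by push_cast; ring,
      show n + ((N + 1 : ℕ) : ℤ) = n + N + 1 by push_cast; ring, e1, e2,
      show tri ((N + 1 : ℕ) : ℤ) - ((N + 1 : ℕ) : ℤ) = (tri N - N) + N by
        push_cast; rw [tri_add_one]; ring]
    simp only [zpow_add₀ ht, zpow_sub₀ ht, zpow_one, zpow_natCast, pow_succ, pow_mul']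
    field_simp
    ring

/-- The partial fraction expansion of `1 / ∏ (1 - x t ^ k) (1 - y t ^ k)` for `x * y = t`. -/
theorem sum_partialFraction {t x y : F} (ht : t ≠ 0) (h1 : ∀ k : ℕ, t ^ (k + 1) ≠ 1)
    (hxy : x * y = t) (hx : ∀ k : ℕ, 1 - x * t ^ k ≠ 0) (hy : ∀ k : ℕ, 1 - y * t ^ k ≠ 0) (n : ℕ) :
    ∑ r ∈ Finset.range (n + 1), (-1) ^ r * t ^ tri r *
      ((1 - t ^ (2 * r + 1)) / ((1 - x * t ^ r) * (1 - y * t ^ r))) *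
      (pochInv t (n - r) * pochInv t (n + r + 1)) =
    (∏ k ∈ Finset.range (n + 1), ((1 - x * t ^ k) * (1 - y * t ^ k)))⁻¹ := by
  induction n with
  | zero =>
    have h2 : (1 : F) - t ≠ 0 := sub_ne_zero.2 (by simpa using (h1 0).symm)
    have h3 := pochInv_natCast t 1
    rw [Nat.cast_one] at h3
    have hx0 := hx 0
    have hy0 := hy 0
    simp [tri_zero, pochInv_zero, h3, poch] at *
    field_simp
  | succ n ih =>
    have hd : (1 - x * t ^ (n + 1)) * (1 - y * t ^ (n + 1)) ≠ 0 := mul_ne_zero (hx _) (hy _)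
    have hn : (1 : F) - t ^ ((n + 1 : ℕ) : ℤ) ≠ 0 := by
      rw [zpow_natCast]; exact sub_ne_zero.2 (h1 n).symm
    -- The upper limit n + 2 exceeds the index n + 1, so the boundary term is zero.
    have hunit := one_sub_mul_sum_unit_bailey ht h1 ((n + 1 : ℕ) : ℤ) (n + 1 + 1)
    rw [pochInv_of_neg t (by push_cast; omega), zero_mul, mul_zero, neg_zero] at hunit
    replace hunit := (mul_eq_zero.1 hunit).resolve_left hn
    rw [Finset.prod_range_succ, mul_inv, ← ih, eq_mul_inv_iff_mul_eq₀ hd, Finset.sum_mul]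
    have hlast : ∑ r ∈ Finset.range (n + 1), (-1) ^ r * t ^ tri r *
        ((1 - t ^ (2 * r + 1)) / ((1 - x * t ^ r) * (1 - y * t ^ r))) *
        (pochInv t (n - r) * pochInv t (n + r + 1)) =
      ∑ r ∈ Finset.range (n + 1 + 1), (-1) ^ r * t ^ tri r *
        ((1 - t ^ (2 * r + 1)) / ((1 - x * t ^ r) * (1 - y * t ^ r))) *
        (pochInv t (n - r) * pochInv t (n + r + 1)) := by
      rw [Finset.sum_range_succ _ (n + 1), pochInv_of_neg t (m := n - ((n + 1 : ℕ) : ℤ)) (by omega)]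
      ring
    rw [hlast, ← sub_eq_zero, ← Finset.sum_sub_distrib]
    refine Eq.trans (Finset.sum_congr rfl fun r hr => ?_)
      ((Finset.mul_sum _ _ (t ^ ((n + 1 : ℕ) : ℤ))).symm.trans (by rw [hunit, mul_zero]))
    have e1 := pochInv_sub_one h1 (((n + 1 : ℕ) : ℤ) - r)
    have e2 := pochInv_sub_one h1 (((n + 1 : ℕ) : ℤ) + r + 1)
    rw [show (n : ℤ) - r = ((n + 1 : ℕ) : ℤ) - r - 1 by push_cast; ring, e1,
      show (n : ℤ) + r + 1 = ((n + 1 : ℕ) : ℤ) + r + 1 - 1 by push_cast; ring, e2]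
    have hxr := hx r
    have hyr := hy r
    -- The inductive step hinges on this identity, where x y = t enters: the difference of the two
    -- sides of the claim loses its denominators and becomes t^(n+1) times the vanishing unit sum.
    have hfac : (1 - x * t ^ (n + 1)) * (1 - y * t ^ (n + 1)) -
        (1 - t ^ (((n + 1 : ℕ) : ℤ) - r)) * (1 - t ^ (((n + 1 : ℕ) : ℤ) + r + 1)) =
        t ^ (((n + 1 : ℕ) : ℤ) - r) * ((1 - x * t ^ r) * (1 - y * t ^ r)) := by
      simp only [zpow_add₀ ht, zpow_sub₀ ht, zpow_one, zpow_natCast]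
      have : t ^ r ≠ 0 := pow_ne_zero _ ht
      field_simp
      linear_combination ((t ^ r) * (t ^ (n + 1)) ^ 2 - (t ^ r) ^ 2 * t ^ (n + 1)) * hxy
    generalize hP : pochInv t (((n + 1 : ℕ) : ℤ) - r) = P at *
    generalize hR : pochInv t (((n + 1 : ℕ) : ℤ) + r + 1) = R at *
    have hsplit : t ^ ((n + 1 : ℕ) : ℤ) * t ^ (tri r - r) = t ^ tri r * t ^ (((n + 1 : ℕ) : ℤ) - r) := by
      rw [← zpow_add₀ ht, ← zpow_add₀ ht]; congr 1; ring
    calc _ = (-1) ^ r * t ^ tri r * ((1 - t ^ (2 * r + 1)) / ((1 - x * t ^ r) * (1 - y * t ^ r))) *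
          (P * R) * ((1 - x * t ^ (n + 1)) * (1 - y * t ^ (n + 1)) -
        (1 - t ^ (((n + 1 : ℕ) : ℤ) - r)) * (1 - t ^ (((n + 1 : ℕ) : ℤ) + r + 1))) := by ring
      _ = (-1) ^ r * (t ^ tri r * t ^ (((n + 1 : ℕ) : ℤ) - r)) * (1 - t ^ (2 * r + 1)) * (P * R) := by
          have hne := mul_ne_zero hxr hyr
          rw [hfac]
          generalize (1 - x * t ^ r) * (1 - y * t ^ r) = D at *
          field_simp
      _ = _ := by rw [← hsplit]; ring

/-- The summand of the finite form of Jacobi's identity. -/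
def jacobiTerm (t : F) (n r : ℤ) : F :=
  (-1) ^ r * t ^ tri r * (pochInv t (n - r) * pochInv t (n + r + 1))

/-- Since 1 + t^(2n+2) = (1 - t^(n+1))² + 2 t^(n+1), passing from n to n + 1 is a scaling minus
t^(n+1) times a second difference in r. -/
theorem jacobiTerm_recurrence {t : F} (ht : t ≠ 0) (h1 : ∀ k : ℕ, t ^ (k + 1) ≠ 1) (n r : ℤ) :
    (1 - t ^ (2 * n + 2)) * (1 - t ^ (2 * n + 3)) * jacobiTerm t (n + 1) r =
      (1 + t ^ (2 * n + 2)) * jacobiTerm t n r -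
        t ^ (n + 1) * (jacobiTerm t n (r - 1) + jacobiTerm t n (r + 1)) := by
  have a1 := pochInv_sub_one h1 (n + 1 - r)
  have a2 := pochInv_sub_one h1 (n + 1 - r - 1)
  have b1 := pochInv_sub_one h1 (n + r + 2)
  have b2 := pochInv_sub_one h1 (n + r + 2 - 1)
  unfold jacobiTerm
  rw [show n + 1 + r + 1 = n + r + 2 by ring, show n - (r - 1) = n + 1 - r by ring,
    show n + (r - 1) + 1 = n + r + 2 - 1 - 1 by ring, show n - r = n + 1 - r - 1 by ring,
    show n + r + 1 = n + r + 2 - 1 by ring, show n - (r + 1) = n + 1 - r - 1 - 1 by ring,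
    show n + (r + 1) + 1 = n + r + 2 by ring, b2, a2, a1, b1, tri_sub_one, tri_add_one]
  have hm : (-1 : F) ≠ 0 := by simp
  rw [show 2 * n + 2 = n + n + 1 + 1 by ring, show 2 * n + 3 = n + n + 1 + 1 + 1 by ring,
    show n + r + 2 = n + r + 1 + 1 by ring]
  simp only [zpow_add₀ ht, zpow_sub₀ ht, zpow_one, zpow_add₀ hm, zpow_sub₀ hm]
  field_simp
  ring

/-- Summation by parts: the weight 2r + 1 is linear, so a second difference contributes only
boundary terms. The one at r = 0 vanishes because the summand is odd under r ↦ -1 - r. -/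
theorem sum_jacobiTerm_shift (t : F) (n : ℤ) (N : ℕ) :
    ∑ r ∈ Finset.range N, (2 * r + 1 : F) *
      (jacobiTerm t n (r - 1) + jacobiTerm t n (r + 1) - 2 * jacobiTerm t n r) =
    (2 * N - 1) * jacobiTerm t n N - (2 * N + 1) * jacobiTerm t n (N - 1) := by
  induction N with
  | zero =>
    have : jacobiTerm t n (-1) = - jacobiTerm t n 0 := by
      unfold jacobiTerm
      rw [show (-1 : ℤ) = -1 - 0 by ring, tri_reflect, tri_zero]
      simp [mul_comm]
    simp [this]
  | succ N ih =>
    rw [Finset.sum_range_succ, ih]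
    push_cast
    rw [add_sub_cancel_right]
    ring

theorem sum_jacobiTerm {t : F} (ht : t ≠ 0) (h1 : ∀ k : ℕ, t ^ (k + 1) ≠ 1) (n N : ℕ)
    (hN : n < N) :
    ∑ r ∈ Finset.range N, (2 * r + 1 : F) * jacobiTerm t n r = poch t n ^ 2 / poch t (2 * n + 1) := by
  induction n with
  | zero =>
    have h2 : (1 : F) - t ≠ 0 := sub_ne_zero.2 (by simpa using (h1 0).symm)
    have h3 := pochInv_natCast t 1
    rw [Nat.cast_one] at h3
    rw [Finset.sum_eq_single_of_mem 0 (by simpa using hN)]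
    · simp [jacobiTerm, tri_zero, pochInv_zero, h3, poch]
    · intro r _ hr
      rw [jacobiTerm, pochInv_of_neg t (by omega)]; simp
  | succ n ih =>
    have hpos (k : ℕ) : (1 : F) - t ^ (k + 1) ≠ 0 := sub_ne_zero.2 (h1 k).symm
    have hs := sum_jacobiTerm_shift t n N
    have hz1 : jacobiTerm t n N = 0 := by
      rw [jacobiTerm, pochInv_of_neg t (by omega)]; simp
    have hz2 : jacobiTerm t n (N - 1) = 0 := by
      rw [jacobiTerm, pochInv_of_neg t (by omega)]; simp
    rw [hz1, hz2, mul_zero, mul_zero, sub_zero] at hs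
    have hrec : (1 - t ^ (2 * n + 2)) * (1 - t ^ (2 * n + 3)) *
        ∑ r ∈ Finset.range N, (2 * r + 1 : F) * jacobiTerm t ((n + 1 : ℕ) : ℤ) r =
        (1 - t ^ (n + 1)) ^ 2 * ∑ r ∈ Finset.range N, (2 * r + 1 : F) * jacobiTerm t n r -
        t ^ (n + 1) * ∑ r ∈ Finset.range N, (2 * r + 1 : F) *
      (jacobiTerm t n (r - 1) + jacobiTerm t n (r + 1) - 2 * jacobiTerm t n r) := by
      rw [Finset.mul_sum, Finset.mul_sum, Finset.mul_sum, ← Finset.sum_sub_distrib]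
      refine Finset.sum_congr rfl fun r _ => ?_
      have := jacobiTerm_recurrence ht h1 n r
      rw [show 2 * (n : ℤ) + 2 = ((2 * n + 2 : ℕ) : ℤ) by push_cast; ring,
        show 2 * (n : ℤ) + 3 = ((2 * n + 3 : ℕ) : ℤ) by push_cast; ring,
        show (n : ℤ) + 1 = ((n + 1 : ℕ) : ℤ) by push_cast; ring] at this
      simp only [zpow_natCast] at this
      rw [show t ^ (2 * n + 2) = (t ^ (n + 1)) ^ 2 by ring] at *
      linear_combination (2 * r + 1 : F) * this
    rw [hs, mul_zero, sub_zero, ih (by omega)] at hrec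
    have h2 : (1 - t ^ (2 * n + 2)) * (1 - t ^ (2 * n + 3)) ≠ 0 := mul_ne_zero (hpos _) (hpos _)
    rw [← mul_right_inj' h2, hrec, show 2 * (n + 1) + 1 = 2 * n + 1 + 1 + 1 by ring]
    have h4 := poch_ne_zero h1 (2 * n + 1)
    have e1 : poch t (n + 1) = poch t n * (1 - t ^ (n + 1)) := Finset.prod_range_succ _ _
    have e2 : poch t (2 * n + 1 + 1 + 1) =
        poch t (2 * n + 1) * (1 - t ^ (2 * n + 2)) * (1 - t ^ (2 * n + 3)) := by
      rw [poch, Finset.prod_range_succ, Finset.prod_range_succ]; rfl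
    have h5 := hpos (2 * n + 1)
    have h6 := hpos (2 * n + 1 + 1)
    rw [e1, e2]
    field_simp

end Finite

/-! ### Limits of the finite identities and Bailey's lemma -/

theorem hasSum_of_forall_eq {ι : Type*} {f g : ι → K} {a : K} (h : HasSum f a)
    (e : ∀ i, f i = g i) : HasSum g a := (funext e : f = g) ▸ h

theorem v_one_sub {f : K} (h : OrdGE 1 f) : Valued.v (1 - f) = 1 :=
  Valuation.map_one_sub_of_lt _ (lt_of_le_of_lt h (by rw [← exp_zero, exp_lt_exp]; norm_num))

theorem one_sub_ne_zero {f : K} (h : OrdGE 1 f) : 1 - f ≠ 0 := fun h0 => by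
  have := v_one_sub h
  rw [h0, map_zero] at this
  exact zero_ne_one this

theorem ordGE_inv {f : K} (h : Valued.v f = 1) : OrdGE 0 f⁻¹ := by
  rw [OrdGE, map_inv₀, h]; simp

theorem ordGE_inv_one_sub {f : K} (h : OrdGE 1 f) : OrdGE 0 (1 - f)⁻¹ :=
  ordGE_inv (v_one_sub h)

theorem OrdGE.pow_natCast {t : K} (ht : OrdGE 1 t) (n : ℕ) : OrdGE n (t ^ n) := by
  induction n with
  | zero => simpa using ordGE_one
  | succ n ih => rw [pow_succ, Nat.cast_succ]; exact ih.mul ht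

theorem OrdGE.pow_succ {t : K} (ht : OrdGE 1 t) (n : ℕ) : OrdGE 1 (t ^ (n + 1)) :=
  (ht.pow_natCast (n + 1)).mono (by omega)

theorem OrdGE.zpow {t : K} (ht : OrdGE 1 t) {n : ℤ} (hn : 0 ≤ n) : OrdGE n (t ^ n) := by
  lift n to ℕ using hn
  rw [zpow_natCast]; exact ht.pow_natCast n

theorem OrdGE.pow_ne_one {t : K} (ht : OrdGE 1 t) (k : ℕ) : t ^ (k + 1) ≠ 1 := fun h =>
  one_sub_ne_zero (ht.pow_succ k) (by rw [h, sub_self])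

theorem v_poch {t : K} (ht : OrdGE 1 t) (n : ℕ) : Valued.v (poch t n) = 1 := by
  rw [poch, map_prod]
  exact Finset.prod_eq_one fun k _ => v_one_sub (ht.pow_succ k)

theorem ordGE_pochInv {t : K} (ht : OrdGE 1 t) (m : ℤ) : OrdGE 0 (pochInv t m) := by
  rcases lt_or_ge m 0 with h | h
  · rw [pochInv_of_neg t h]; exact ordGE_zero 0
  · lift m to ℕ using h
    rw [pochInv_natCast]; exact ordGE_inv (v_poch ht m)

section Limit

variable {t P : K} (ht : OrdGE 1 t) (hP : Tendsto (poch t) atTop (𝓝 P))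

include ht hP

theorem pochLimit_ne_zero : P ≠ 0 := by
  rintro rfl
  obtain ⟨n, hn⟩ := (tendsto_iff_ordGE.1 hP 1).exists
  rw [sub_zero, OrdGE, v_poch ht n, ← exp_zero, exp_le_exp] at hn
  omega

theorem tendsto_pochInv {u : ℕ → ℤ} (hu : Tendsto u atTop atTop) :
    Tendsto (fun n => pochInv t (u n)) atTop (𝓝 P⁻¹) := by
  have h1 : Tendsto (fun n => (poch t (u n).toNat)⁻¹) atTop (𝓝 P⁻¹) :=
    (hP.comp (tendsto_atTop.2 fun b => (hu.eventually_ge_atTop (b : ℤ)).mono fun n hn => by omega)).inv₀ (pochLimit_ne_zero ht hP)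
  refine h1.congr' ?_
  filter_upwards [hu.eventually_ge_atTop 0] with n hn
  rw [pochInv, if_pos hn]

theorem tendsto_sum_mul_pochInv {g : ℕ → K} (hg : ∀ r, OrdGE 0 (g r)) :
    Tendsto (fun n : ℕ => ∑ r ∈ Finset.range (n + 1), (-1) ^ r * t ^ tri r * g r *
      (pochInv t (n - r) * pochInv t (n + r + 1))) atTop
      (𝓝 (∑' r : ℕ, (-1) ^ r * t ^ tri r * g r * (P⁻¹ * P⁻¹))) := by
  have hsum (n : ℕ) : ∑ r ∈ Finset.range (n + 1), (-1) ^ r * t ^ tri r * g r *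
      (pochInv t (n - r) * pochInv t (n + r + 1)) = ∑' r : ℕ, (-1) ^ r * t ^ tri r * g r *
      (pochInv t (n - r) * pochInv t (n + r + 1)) := by
    refine (tsum_eq_sum fun r hr => ?_).symm
    rw [Finset.mem_range] at hr
    rw [pochInv_of_neg t (m := n - r) (by omega), zero_mul, mul_zero]
  simp_rw [hsum]
  refine tendsto_tsum_of_ordGE (fun r : ℕ => (r : ℤ)) finite_natCast_lt (fun n r => ?_) fun r => ?_
  · refine (OrdGE.mul_right ?_ (hg r)).mul_right
      ((ordGE_pochInv ht _).mul_right (ordGE_pochInv ht _))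
    exact (ordGE_one.neg.pow r).mul_left ((ht.zpow (tri_nonneg r)).mono self_le_tri)
  · refine ((tendsto_pochInv ht hP ?_).mul (tendsto_pochInv ht hP ?_)).const_mul _
    · exact tendsto_atTop_add_const_right _ (-(r : ℤ)) tendsto_natCast_atTop_atTop
    · exact tendsto_atTop_add_const_right _ 1
        (tendsto_atTop_add_const_right _ (r : ℤ) tendsto_natCast_atTop_atTop)

omit hP in
theorem ordGE_durfeeTerm (m k : ℕ) :
    OrdGE k (t ^ (k * k + k * m) * (pochInv t k * pochInv t (k + m))) :=
  OrdGE.mul_right ((ht.pow_natCast _).mono (by push_cast; nlinarith))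
    ((ordGE_pochInv ht _).mul_right (ordGE_pochInv ht _))

omit hP in
theorem summable_durfeeTerm (m : ℕ) :
    Summable fun k : ℕ => t ^ (k * k + k * m) * (pochInv t k * pochInv t (k + m)) :=
  summable_of_ordGE (fun k : ℕ => (k : ℤ)) finite_natCast_lt (ordGE_durfeeTerm ht m)

omit hP in
theorem tsum_durfeeTerm_recurrence (m : ℕ) :
    (∑' k : ℕ, t ^ (k * k + k * m) * (pochInv t k * pochInv t (k + m))) -
      ∑' k : ℕ, t ^ (k * k + k * (m + 1)) * (pochInv t k * pochInv t (k + (m + 1 : ℕ))) =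
    -t ^ (m + 1) *
      ((∑' k : ℕ, t ^ (k * k + k * (m + 1)) * (pochInv t k * pochInv t (k + (m + 1 : ℕ)))) -
      ∑' k : ℕ, t ^ (k * k + k * (m + 2)) * (pochInv t k * pochInv t (k + (m + 2 : ℕ)))) := by
  have s0 := summable_durfeeTerm ht m
  have s1 := summable_durfeeTerm ht (m + 1)
  have key (k : ℕ) : t ^ (k * k + k * m) * (pochInv t k * pochInv t (k + m)) -
      t ^ (k * k + k * (m + 1)) * (pochInv t k * pochInv t (k + (m + 1 : ℕ))) +
      t ^ (m + 1) * (t ^ (k * k + k * (m + 1)) * (pochInv t k * pochInv t (k + (m + 1 : ℕ)))) =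
      t ^ (k * k + k * m) * (pochInv t (k - 1) * pochInv t (k + (m + 1 : ℕ))) := by
    have e1 := pochInv_sub_one ht.pow_ne_one (k : ℤ)
    have e2 := pochInv_sub_one ht.pow_ne_one (k + (m + 1 : ℕ) : ℤ)
    rw [show (k + (m + 1 : ℕ) : ℤ) - 1 = k + m by push_cast; ring,
      show (k + (m + 1 : ℕ) : ℤ) = ((k + m + 1 : ℕ) : ℤ) by push_cast; ring] at e2
    rw [e1, e2, show (k + (m + 1 : ℕ) : ℤ) = ((k + m + 1 : ℕ) : ℤ) by push_cast; ring]
    simp only [zpow_natCast]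
    ring
  have hs := (s0.sub s1).add (s1.mul_left (t ^ (m + 1)))
  have h3 : ∑' k : ℕ, t ^ (k * k + k * m) * (pochInv t (k - 1) * pochInv t (k + (m + 1 : ℕ))) =
      t ^ (m + 1) *
        ∑' k : ℕ, t ^ (k * k + k * (m + 2)) * (pochInv t k * pochInv t (k + (m + 2 : ℕ))) := by
    simp_rw [key] at hs
    rw [hs.tsum_eq_zero_add, ← tsum_mul_left]
    rw [pochInv_of_neg t (m := ((0 : ℕ) : ℤ) - 1) (by omega), zero_mul (pochInv t _), mul_zero,
      zero_add]
    refine tsum_congr fun k => ?_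
    rw [show ((k + 1 : ℕ) : ℤ) - 1 = k by push_cast; ring,
      show ((k + 1 : ℕ) : ℤ) + (m + 1 : ℕ) = k + (m + 2 : ℕ) by push_cast; ring]
    ring
  rw [← tsum_congr key, (s0.sub s1).tsum_add (s1.mul_left _), s0.tsum_sub s1, tsum_mul_left] at h3
  linear_combination h3

/-- The Durfee rectangle identity. -/
theorem hasSum_durfee (m : ℕ) :
    HasSum (fun k : ℕ => t ^ (k * k + k * m) * (pochInv t k * pochInv t (k + m))) P⁻¹ := by
  let U (m : ℕ) : K := ∑' k : ℕ, t ^ (k * k + k * m) * (pochInv t k * pochInv t (k + m))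
  have hrec (m : ℕ) : U m - U (m + 1) = -t ^ (m + 1) * (U (m + 1) - U (m + 2)) :=
    tsum_durfeeTerm_recurrence ht m
  have hU (m : ℕ) : OrdGE 0 (U m) :=
    ordGE_tsum fun k => (ordGE_durfeeTerm ht m k).mono (by omega)
  -- Each use of the recurrence gains a factor of order at least one, so consecutive differences are
  -- divisible by every power of q and `U` is constant.
  have hord (D : ℕ) : ∀ m, OrdGE D (U m - U (m + 1)) := by
    induction D with
    | zero => exact fun m => (hU _).sub (hU _)
    | succ D ih =>
      intro m
      rw [hrec, Nat.cast_succ, add_comm]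
      exact (ht.pow_succ m).neg.mul (ih (m + 1))
  have hstep (m : ℕ) : U m = U 0 := by
    induction m with
    | zero => rfl
    | succ m ih => rw [← ih, ← sub_eq_zero.1 (eq_zero_of_ordGE fun D => hord D m)]
  -- The constant is found at m → ∞, where the exponent k m kills every term but k = 0.
  have hlim : Tendsto U atTop (𝓝 (∑' k : ℕ, if k = 0 then P⁻¹ else 0)) := by
    refine tendsto_tsum_of_ordGE (fun r : ℕ => (r : ℤ)) finite_natCast_lt
      (fun n r => ordGE_durfeeTerm ht n r) fun k => ?_
    have h2 := tendsto_pochInv ht hP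
      (tendsto_atTop_add_const_left _ (k : ℤ) tendsto_natCast_atTop_atTop)
    rcases Nat.eq_zero_or_pos k with rfl | hk
    · simpa [pochInv_zero] using h2
    · rw [if_neg hk.ne', tendsto_iff_ordGE]
      intro D
      filter_upwards [eventually_ge_atTop D.toNat] with n hn
      rw [sub_zero]
      refine OrdGE.mul_right ((ht.pow_natCast _).mono ?_)
        ((ordGE_pochInv ht _).mul_right (ordGE_pochInv ht _))
      have : n ≤ k * n := Nat.le_mul_of_pos_left n hk
      have : n ≤ k * k + k * n := by omega
      omega
  rw [tsum_ite_eq] at hlim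
  have hUm : U m = P⁻¹ := by
    rw [hstep m]
    refine tendsto_nhds_unique ?_ hlim
    rw [show U = fun _ => U 0 from funext hstep]
    exact tendsto_const_nhds
  rw [← hUm]
  exact (summable_durfeeTerm ht m).hasSum

theorem hasSum_bailey {x y : K} (ht0 : t ≠ 0) (hxy : x * y = t) (hx : OrdGE 1 x) (hy : OrdGE 1 y) :
    HasSum (fun n : ℕ => t ^ (n * n + n) *
      (∏ k ∈ Finset.range (n + 1), ((1 - x * t ^ k) * (1 - y * t ^ k)))⁻¹)
      (∑' r : ℕ, (-1) ^ r * t ^ tri r *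
        ((1 - t ^ (2 * r + 1)) / ((1 - x * t ^ r) * (1 - y * t ^ r))) * t ^ (r * r + r) * P⁻¹) := by
  have hx1 (k : ℕ) : OrdGE 1 (x * t ^ k) :=
    hx.mul_right ((ht.pow_natCast k).mono (by omega))
  have hy1 (k : ℕ) : OrdGE 1 (y * t ^ k) :=
    hy.mul_right ((ht.pow_natCast k).mono (by omega))
  set g : ℕ → K := fun r => (1 - t ^ (2 * r + 1)) / ((1 - x * t ^ r) * (1 - y * t ^ r)) with hg
  have hg0 (r : ℕ) : OrdGE 0 (g r) := by
    rw [hg]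
    simp only
    rw [div_eq_mul_inv, mul_inv]
    exact (ordGE_one.sub ((ht.pow_natCast _).mono (by omega))).mul_left
      ((ordGE_inv_one_sub (hx1 r)).mul_left (ordGE_inv_one_sub (hy1 r)))
  let F : ℕ × ℕ → K := fun p => (-1) ^ p.1 * t ^ tri p.1 * g p.1 *
    t ^ ((p.1 + p.2) * (p.1 + p.2) + (p.1 + p.2)) * (pochInv t p.2 * pochInv t (2 * p.1 + p.2 + 1))
  have hF : Summable F := by
    refine summable_of_ordGE (fun p : ℕ × ℕ => (p.1 : ℤ) + p.2) finite_natCast_add_natCast_lt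
      fun p => ?_
    refine OrdGE.mul_right ?_ ((ordGE_pochInv ht _).mul_right (ordGE_pochInv ht _))
    refine OrdGE.mul_left ?_ ((ht.pow_natCast _).mono ?_)
    · exact ((ordGE_one.neg.pow _).mul_left ((ht.zpow (tri_nonneg _)).mono (tri_nonneg _))).mul_left
        (hg0 _)
    · push_cast; nlinarith
  have h1 : HasSum F (∑' r : ℕ, (-1) ^ r * t ^ tri r * g r * t ^ (r * r + r) * P⁻¹) := by
    -- With n = r + k, n² + n = (r² + r) + k² + k(2r + 1), so the inner sum is the Durfee identity
    -- for m = 2r + 1. Summing along r + k = n instead recovers the partial fraction expansion.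
    have hfib (r : ℕ) : HasSum (fun k => F (r, k))
        ((-1) ^ r * t ^ tri r * g r * t ^ (r * r + r) * P⁻¹) := by
      refine hasSum_of_forall_eq ((hasSum_durfee ht hP (2 * r + 1)).mul_left
        ((-1) ^ r * t ^ tri r * g r * t ^ (r * r + r))) fun k => ?_
      rw [show (k : ℤ) + (2 * r + 1 : ℕ) = 2 * r + k + 1 by push_cast; ring]
      simp only [F]
      ring
    rw [(hF.hasSum.prod_fiberwise hfib).tsum_eq]
    exact hF.hasSum
  have h2 := ((Finset.HasAntidiagonal.sigmaAntidiagonalEquivProd (A := ℕ)).hasSum_iff.2 h1).sigma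
    fun n => hasSum_fintype _
  refine hasSum_of_forall_eq h2 fun n => ?_
  rw [← sum_partialFraction ht0 ht.pow_ne_one hxy (fun k => one_sub_ne_zero (hx1 k))
    (fun k => one_sub_ne_zero (hy1 k)) n]
  refine (Finset.sum_coe_sort (Finset.HasAntidiagonal.antidiagonal n) F).trans ?_
  rw [Finset.Nat.sum_antidiagonal_eq_sum_range_succ_mk, Finset.mul_sum]
  refine Finset.sum_congr rfl fun r hr => ?_
  have hrn : r ≤ n := by simpa [Nat.lt_succ_iff] using hr
  simp only [F, g]
  rw [Nat.add_sub_cancel' hrn, Nat.cast_sub hrn,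
    show 2 * (r : ℤ) + (n - r) + 1 = n + r + 1 by ring]
  ring

end Limit

/-! ### The Euler product, bilateral sums and Jacobi's identity -/

theorem ordGE_q : OrdGE 1 q := by simpa using ordGE_q_zpow (n := 1) le_rfl

theorem ordGE_q_pow {n : ℕ} (hn : 1 ≤ n) : OrdGE 1 (q ^ n) :=
  (ordGE_q.pow_natCast n).mono (by omega)

/-- The Euler product `∏ (1 - q ^ n)` as a Laurent series. -/
noncomputable def euler : K := toK (PowerSeries.pentagonalSeries ℤ)

theorem tendsto_poch_q : Tendsto (poch q) atTop (𝓝 euler) := by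
  have h := (PowerSeries.WithPiTopology.hasProd_one_sub_X_pow ℤ).tendsto_prod_nat
  refine ((continuous_toK.tendsto _).comp h).congr fun n => ?_
  simp [poch, map_prod, toK_X]

theorem cube_poch_q (n : ℕ) : cube (poch q n) = poch (q ^ 3) n := by
  simp [poch, map_prod, cube_q]

theorem tendsto_poch_q_cube : Tendsto (poch (q ^ 3)) atTop (𝓝 (cube euler)) :=
  ((continuous_cube.tendsto _).comp tendsto_poch_q).congr cube_poch_q

theorem euler_ne_zero : euler ≠ 0 := pochLimit_ne_zero ordGE_q tendsto_poch_q

theorem cube_euler_ne_zero : cube euler ≠ 0 := (map_ne_zero cube).2 euler_ne_zero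

theorem hasSum_euler' : HasSum (fun k : ℤ => (-1 : K) ^ k * q ^ (3 * tri k - 2 * k)) euler := by
  refine hasSum_of_forall_eq
    ((PowerSeries.WithPiTopology.hasSum_pentagonalSeries ℤ).map toK continuous_toK) fun k => ?_
  have h1 := two_mul_natCast_pentagonal k
  have h2 := two_mul_tri k
  have h3 : 3 * tri k - 2 * k = pentagonal k := by linarith
  rw [Function.comp_apply, map_mul, map_pow, toK_X, h3, zpow_natCast]
  congr 1
  rcases Int.even_or_odd k with h | h
  · simp [Int.negOnePow_even k h, h.neg_one_zpow]
  · simp [Int.negOnePow_odd k h, h.neg_one_zpow]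

theorem hasSum_euler : HasSum (fun k : ℤ => (-1 : K) ^ k * q ^ (3 * tri k - k)) euler := by
  refine hasSum_of_forall_eq ((Equiv.neg ℤ).hasSum_iff.2 hasSum_euler') fun k => ?_
  have h1 := two_mul_tri k
  have h2 := two_mul_tri (-k)
  rw [Function.comp_apply, Equiv.neg_apply, show 3 * tri (-k) - 2 * -k = 3 * tri k - k by linarith]
  rcases Int.even_or_odd k with h | h
  · rw [h.neg.neg_one_zpow, h.neg_one_zpow]
  · rw [h.neg.neg_one_zpow, h.neg_one_zpow]

theorem tsum_int_eq_tsum_nat {f : ℤ → K} (hf : Summable f) :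
    ∑' k : ℤ, f k = ∑' n : ℕ, (f n + f (-(n + 1))) :=
  hf.hasSum.nat_add_neg_add_one.tsum_eq.symm

theorem neg_one_zpow_reflect (n : ℕ) : (-1 : K) ^ (-((n : ℤ) + 1)) = -(-1) ^ n := by
  rw [zpow_neg, zpow_add₀ (by simp), zpow_natCast]
  rcases Nat.even_or_odd n with h | h <;> simp [h.neg_one_pow]

theorem tri_neg_succ (x : ℤ) : tri (-(x + 1)) = tri x := by
  rw [show -(x + 1) = -1 - x by ring, tri_reflect]

theorem one_sub_q_zpow_ne_zero {n : ℤ} (hn : n ≠ 0) : 1 - q ^ n ≠ 0 := by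
  intro h
  have h2 := congr_arg Valued.v (sub_eq_zero.1 h)
  rw [v_q_zpow, map_one, ← exp_zero, exp_inj] at h2
  omega

theorem inv_one_sub_q_zpow_neg {n : ℤ} (hn : n ≠ 0) :
    (1 - q ^ (-n))⁻¹ = -(q ^ n * (1 - q ^ n)⁻¹) := by
  have h1 := one_sub_q_zpow_ne_zero hn
  have h2 := one_sub_q_zpow_ne_zero (neg_ne_zero.2 hn)
  have h3 : q ^ n ≠ 0 := zpow_ne_zero _ q_ne_zero
  rw [zpow_neg] at *
  field_simp
  rw [div_eq_iff]
  · ring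
  exact fun h => h1 (by rw [← neg_sub, h, neg_zero])

theorem ordGE_inv_one_sub_q_zpow {n : ℤ} (hn : n ≠ 0) : OrdGE 0 (1 - q ^ n)⁻¹ := by
  rcases lt_or_gt_of_ne hn with h | h
  · rw [← neg_neg n, inv_one_sub_q_zpow_neg (by omega)]
    exact ((ordGE_q_zpow (by omega)).mul_left (ordGE_inv_one_sub (ordGE_q_zpow (by omega)))).neg
  · exact ordGE_inv_one_sub (ordGE_q_zpow (by omega))

theorem ordGE_inv_one_sub_q_zpow' {n : ℤ} (hn : n ≠ 0) : OrdGE (-n) (1 - q ^ n)⁻¹ := by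
  rcases lt_or_gt_of_ne hn with h | h
  · rw [← neg_neg n, inv_one_sub_q_zpow_neg (by omega), neg_neg]
    exact ((ordGE_q_zpow le_rfl).mul_right (ordGE_inv_one_sub (ordGE_q_zpow (by omega)))).neg
  · exact (ordGE_inv_one_sub_q_zpow hn).mono (by omega)

/-- The series `1 / (1 - q ^ (3 k + a))`. -/
noncomputable def geom (a k : ℤ) : K := (1 - q ^ (3 * k + a))⁻¹

/-- For negative k the factor 1/(1 - q^(3k+1)) has order -(3k+1), which outweighs the negative
exponent b k. -/
theorem summable_theta_mul_geom {c b : ℤ} (hc : 3 ≤ c) (hb0 : 0 ≤ b) (hb : b ≤ 2) :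
    Summable fun k : ℤ => (-1 : K) ^ k * q ^ (c * tri k + b * k) * geom 1 k := by
  refine summable_of_ordGE (fun k => |k| - 3) (fun D => by
    simpa only [sub_lt_iff_lt_add] using finite_abs_lt (D + 3)) fun k => ?_
  have h1 := abs_le_tri_add_one k
  have h3 : 3 * tri k ≤ c * tri k := mul_le_mul_of_nonneg_right hc (tri_nonneg k)
  rcases le_or_gt 0 k with h | h
  · have h4 : 0 ≤ b * k := mul_nonneg hb0 h
    refine ((ordGE_neg_one_zpow k).mul_left (ordGE_q_zpow ?_)).mul_right
      (ordGE_inv_one_sub_q_zpow (by omega))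
    have := tri_nonneg k
    omega
  · have h4 : 2 * k ≤ b * k := mul_le_mul_of_nonpos_right hb h.le
    refine (((ordGE_neg_one_zpow k).mul_left (ordGE_q_zpow le_rfl)).mul
      (ordGE_inv_one_sub_q_zpow' (n := 3 * k + 1) (by omega))).mono ?_
    have := tri_nonneg k
    omega

theorem geom_sub_geom_reflect (r : ℕ) :
    geom 1 r - geom 1 (-(r + 1)) =
      (1 - (q ^ 3) ^ (2 * r + 1)) / ((1 - q * (q ^ 3) ^ r) * (1 - q ^ 2 * (q ^ 3) ^ r)) := by
  have h1 := one_sub_q_zpow_ne_zero (n := ((3 * r + 1 : ℕ) : ℤ)) (by omega)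
  have h2 := one_sub_q_zpow_ne_zero (n := ((3 * r + 2 : ℕ) : ℤ)) (by omega)
  rw [geom, geom, show 3 * -((r : ℤ) + 1) + 1 = -((3 * r + 2 : ℕ) : ℤ) by push_cast; ring,
    inv_one_sub_q_zpow_neg (by omega),
    show 3 * (r : ℤ) + 1 = ((3 * r + 1 : ℕ) : ℤ) by push_cast; ring]
  rw [zpow_natCast] at *
  rw [show q * (q ^ 3) ^ r = q ^ (3 * r + 1) by ring,
    show q ^ 2 * (q ^ 3) ^ r = q ^ (3 * r + 2) by ring]
  rw [zpow_natCast]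
  field_simp
  ring

/-- Pairing k = r with k = -(r+1) folds the bilateral sum onto the summands of the partial fraction
expansion with x = q, y = q², t = q³. -/
theorem tsum_theta_mul_geom {c : ℕ} (hc : 3 ≤ c) :
    ∑' k : ℤ, (-1 : K) ^ k * q ^ (c * tri k) * geom 1 k =
      ∑' r : ℕ, (-1) ^ r * q ^ (c * tri r) *
        ((1 - (q ^ 3) ^ (2 * r + 1)) / ((1 - q * (q ^ 3) ^ r) * (1 - q ^ 2 * (q ^ 3) ^ r))) := by
  have hs := summable_theta_mul_geom (c := c) (b := 0) (mod_cast hc) le_rfl (by norm_num)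
  simp only [zero_mul, add_zero] at hs
  rw [tsum_int_eq_tsum_nat hs]
  refine tsum_congr fun r => ?_
  rw [← geom_sub_geom_reflect, neg_one_zpow_reflect, tri_neg_succ, zpow_natCast]
  ring

/-- The generalized Lambert series `∑ (-1) ^ k q ^ (3 k (k + 1) / 2 + b k) / (1 - q ^ (3 k + 1))`. -/
noncomputable def appell (b : ℤ) : K :=
  ∑' k : ℤ, (-1 : K) ^ k * q ^ (3 * tri k + b * k) * geom 1 k

theorem prod_range_mul_eq_poch_div (n : ℕ) :
    ∏ k ∈ Finset.range n, ((1 - q * (q ^ 3) ^ k) * (1 - q ^ 2 * (q ^ 3) ^ k)) =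
      poch q (3 * n) / poch (q ^ 3) n := by
  have h (n) := poch_ne_zero ((ordGE_q_pow (n := 3) (by omega)).pow_ne_one) n
  rw [eq_div_iff (h n)]
  induction n with
  | zero => simp [poch]
  | succ n ih =>
    have e1 : poch q (3 * (n + 1)) = poch q (3 * n) * (1 - q ^ (3 * n + 1)) *
        (1 - q ^ (3 * n + 2)) * (1 - q ^ (3 * n + 3)) := by
      rw [show 3 * (n + 1) = 3 * n + 1 + 1 + 1 by ring, poch, Finset.prod_range_succ,
        Finset.prod_range_succ, Finset.prod_range_succ]
      rfl
    have e2 : poch (q ^ 3) (n + 1) = poch (q ^ 3) n * (1 - (q ^ 3) ^ (n + 1)) :=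
      Finset.prod_range_succ _ _
    rw [e1, e2, Finset.prod_range_succ, ← ih]
    ring

/-- This is the limit n → ∞ of the partial fraction expansion: the sum tends to A_0 / E(q³)² and the
product to E(q³) / E(q). -/
theorem appell_zero_mul_euler : appell 0 * euler = cube euler ^ 3 := by
  have ht : OrdGE 1 (q ^ 3) := ordGE_q_pow (by omega)
  have hx (k : ℕ) : OrdGE 1 (q * (q ^ 3) ^ k) :=
    ordGE_q.mul_right ((ht.pow_natCast k).mono (by omega))
  have hy (k : ℕ) : OrdGE 1 (q ^ 2 * (q ^ 3) ^ k) :=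
    (ordGE_q_pow (by omega)).mul_right ((ht.pow_natCast k).mono (by omega))
  have h1 := tendsto_sum_mul_pochInv ht tendsto_poch_q_cube
    (g := fun r => (1 - (q ^ 3) ^ (2 * r + 1)) / ((1 - q * (q ^ 3) ^ r) * (1 - q ^ 2 * (q ^ 3) ^ r)))
    fun r => by
      rw [div_eq_mul_inv, mul_inv]
      exact (ordGE_one.sub ((ht.pow_natCast _).mono (by omega))).mul_left
        ((ordGE_inv_one_sub (hx r)).mul_left (ordGE_inv_one_sub (hy r)))
  simp_rw [sum_partialFraction (pow_ne_zero 3 q_ne_zero) ht.pow_ne_one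
    (show q * q ^ 2 = q ^ 3 by ring) (fun k => one_sub_ne_zero (hx k))
    (fun k => one_sub_ne_zero (hy k)), prod_range_mul_eq_poch_div] at h1
  have h2 : Tendsto (fun n => (poch q (3 * (n + 1)) / poch (q ^ 3) (n + 1))⁻¹) atTop
      (𝓝 (euler / cube euler)⁻¹) := by
    refine Tendsto.inv₀ (Tendsto.div ?_ ?_ cube_euler_ne_zero)
      (div_ne_zero euler_ne_zero cube_euler_ne_zero)
    · exact tendsto_poch_q.comp (tendsto_atTop_mono (fun n => by simp; omega) tendsto_id)
    · exact tendsto_poch_q_cube.comp (tendsto_add_atTop_nat 1)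
  have h3 := tendsto_nhds_unique h1 h2
  rw [tsum_mul_right] at h3
  have h4 := tsum_theta_mul_geom (c := 3) le_rfl
  have h5 (r : ℕ) : (q ^ 3) ^ tri r = q ^ (((3 : ℕ) : ℤ) * tri r) := by
    rw [zpow_mul, zpow_natCast]
  simp_rw [h5] at h3
  rw [← h4] at h3
  have h6 : appell 0 = ∑' k : ℤ, (-1 : K) ^ k * q ^ (((3 : ℕ) : ℤ) * tri k) * geom 1 k := by
    simp [appell]
  rw [← h6] at h3
  have := euler_ne_zero
  have := cube_euler_ne_zero
  field_simp at h3
  exact h3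

theorem ordGE_jacobi (r : ℕ) : OrdGE 0 ((2 * r + 1 : K)) := by
  exact_mod_cast ordGE_natCast (2 * r + 1)

/-- Jacobi's identity for the cube of the Euler product. -/
theorem hasSum_euler_cubed :
    HasSum (fun r : ℕ => (-1) ^ r * q ^ tri r * (2 * r + 1 : K)) (euler ^ 3) := by
  have h1 := tendsto_sum_mul_pochInv ordGE_q tendsto_poch_q ordGE_jacobi
  have hs (n : ℕ) : ∑ r ∈ Finset.range (n + 1), (-1) ^ r * q ^ tri r * (2 * r + 1 : K) *
      (pochInv q (n - r) * pochInv q (n + r + 1)) = poch q n ^ 2 / poch q (2 * n + 1) := by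
    rw [← sum_jacobiTerm q_ne_zero ordGE_q.pow_ne_one n (n + 1) (by omega)]
    refine Finset.sum_congr rfl fun r _ => ?_
    rw [jacobiTerm, zpow_natCast]
    ring
  simp_rw [hs] at h1
  have h2 : Tendsto (fun n => poch q n ^ 2 / poch q (2 * n + 1)) atTop (𝓝 (euler ^ 2 / euler)) :=
    (tendsto_poch_q.pow 2).div
      (tendsto_poch_q.comp (tendsto_atTop_mono (fun n => by simp; omega) tendsto_id)) euler_ne_zero
  have h3 := tendsto_nhds_unique h1 h2
  rw [tsum_mul_right] at h3
  have hsum : Summable fun r : ℕ => (-1) ^ r * q ^ tri r * (2 * r + 1 : K) := by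
    refine summable_of_ordGE (fun r : ℕ => (r : ℤ)) finite_natCast_lt fun r => ?_
    exact ((ordGE_one.neg.pow r).mul_left (ordGE_q_zpow self_le_tri)).mul_right (ordGE_jacobi r)
  have := euler_ne_zero
  field_simp at h3
  rw [← h3]
  exact hsum.hasSum

/-- Here k = r and k = -(r+1) share a triangular number and have opposite signs, so their weights
combine to r + (r + 1) = 2r + 1. -/
theorem hasSum_euler_cubed_int :
    HasSum (fun k : ℤ => (-1 : K) ^ k * q ^ tri k * k) (euler ^ 3) := by
  have hs : Summable fun k : ℤ => (-1 : K) ^ k * q ^ tri k * k := by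
    refine summable_of_ordGE (fun k => |k| - 1) (fun D => by
      simpa only [sub_lt_iff_lt_add] using finite_abs_lt (D + 1)) fun k => ?_
    exact ((ordGE_neg_one_zpow k).mul_left
      (ordGE_q_zpow (by linarith [abs_le_tri_add_one k]))).mul_right (ordGE_intCast k)
  have h := tsum_int_eq_tsum_nat hs
  have h2 : ∑' k : ℤ, (-1 : K) ^ k * q ^ tri k * k = euler ^ 3 := by
    rw [h, ← hasSum_euler_cubed.tsum_eq]
    refine tsum_congr fun r => ?_
    rw [neg_one_zpow_reflect, tri_neg_succ, zpow_natCast]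
    push_cast
    ring
  rw [← h2]
  exact hs.hasSum

/-! ### Three-dissection of β -/

/-- The series whose `n`-th coefficient is the coefficient of `f` at `3 n + i`. -/
noncomputable def dissect (i : ℕ) (f : ℤ⟦X⟧) : ℤ⟦X⟧ :=
  PowerSeries.mk fun n => PowerSeries.coeff (3 * n + i) f

theorem coeff_dissect (i : ℕ) (f : ℤ⟦X⟧) (n : ℕ) :
    PowerSeries.coeff n (dissect i f) = PowerSeries.coeff (3 * n + i) f :=
  PowerSeries.coeff_mk _ _

theorem eq_sum_dissect (f : ℤ⟦X⟧) :
    f = PowerSeries.expand 3 three_ne_zero (dissect 0 f) +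
      PowerSeries.X * PowerSeries.expand 3 three_ne_zero (dissect 1 f) +
      PowerSeries.X ^ 2 * PowerSeries.expand 3 three_ne_zero (dissect 2 f) := by
  ext n
  have h1 := PowerSeries.coeff_X_pow_mul' (PowerSeries.expand 3 three_ne_zero (dissect 1 f)) 1 n
  have h2 := PowerSeries.coeff_X_pow_mul' (PowerSeries.expand 3 three_ne_zero (dissect 2 f)) 2 n
  rw [pow_one] at h1
  rw [map_add, map_add, h1, h2]
  simp only [PowerSeries.coeff_expand, coeff_dissect]
  obtain ⟨m, rfl | rfl | rfl⟩ : ∃ m, n = 3 * m ∨ n = 3 * m + 1 ∨ n = 3 * m + 2 :=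
    ⟨n / 3, by omega⟩
  · rw [if_pos (by omega)]
    have : ¬ (1 ≤ 3 * m ∧ 3 ∣ 3 * m - 1) := by omega
    have : ¬ (2 ≤ 3 * m ∧ 3 ∣ 3 * m - 2) := by omega
    simp_all
  · rw [if_neg (by omega), if_pos (by omega), if_pos (by omega)]
    have : ¬ (2 ≤ 3 * m + 1 ∧ 3 ∣ 3 * m + 1 - 2) := by omega
    simp_all
  · rw [if_neg (by omega), if_pos (by omega), if_neg (by omega), if_pos (by omega),
      if_pos (by omega)]
    simp

theorem toK_eq_sum_dissect (f : ℤ⟦X⟧) :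
    toK f = cube (toK (dissect 0 f)) + q * cube (toK (dissect 1 f)) +
      q ^ 2 * cube (toK (dissect 2 f)) := by
  conv_lhs => rw [eq_sum_dissect f]
  simp only [map_add, map_mul, map_pow, toK_X, cube_toK]

theorem toK_betaSummand (n : ℕ) :
    toK (betaSummand n) = q * ((q ^ 3) ^ (n * n + n) *
      (∏ k ∈ Finset.range (n + 1), ((1 - q * (q ^ 3) ^ k) * (1 - q ^ 2 * (q ^ 3) ^ k)))⁻¹) := by
  have h := congr_arg toK (betaSummand_mul_betaDenominator n)
  have hd : toK (betaDenominator n) =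
      ∏ k ∈ Finset.range (n + 1), ((1 - q * (q ^ 3) ^ k) * (1 - q ^ 2 * (q ^ 3) ^ k)) := by
    simp [betaDenominator, qShiftedFactorial, toK_X, Finset.prod_mul_distrib]
  have ht : OrdGE 1 (q ^ 3) := ordGE_q_pow (by omega)
  have hne : ∏ k ∈ Finset.range (n + 1), ((1 - q * (q ^ 3) ^ k) * (1 - q ^ 2 * (q ^ 3) ^ k)) ≠ 0 :=
    Finset.prod_ne_zero_iff.2 fun k _ => mul_ne_zero
      (one_sub_ne_zero (ordGE_q.mul_right ((ht.pow_natCast k).mono (by omega))))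
      (one_sub_ne_zero ((ordGE_q_pow (by omega)).mul_right ((ht.pow_natCast k).mono (by omega))))
  rw [map_mul, hd, map_pow, toK_X] at h
  rw [eq_comm, ← mul_assoc, ← div_eq_mul_inv, div_eq_iff hne, h]
  ring

/-- Bailey's lemma with t = q³, x = q, y = q²; the exponents 3 tri r and 3(r² + r) = 6 tri r add up
to 9 tri r. -/
theorem toK_mockThetaBeta_mul :
    toK mockThetaBeta * cube euler =
      q * ∑' k : ℤ, (-1 : K) ^ k * q ^ (9 * tri k) * geom 1 k := by
  have ht : OrdGE 1 (q ^ 3) := ordGE_q_pow (by omega)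
  have h1 := (hasSum_bailey ht tendsto_poch_q_cube (pow_ne_zero 3 q_ne_zero)
    (show q * q ^ 2 = q ^ 3 by ring) ordGE_q (ordGE_q_pow (by omega))).mul_left q
  have h2 := summable_betaSummand.hasSum.map toK continuous_toK
  have h3 := h2.unique (hasSum_of_forall_eq h1 fun n => (toK_betaSummand n).symm)
  have h4 := tsum_theta_mul_geom (c := 9) (by omega)
  rw [Nat.cast_ofNat] at h4
  rw [mockThetaBeta, h3, h4, tsum_mul_right, mul_assoc, inv_mul_cancel_right₀ cube_euler_ne_zero]
  congr 1
  refine tsum_congr fun r => ?_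
  have e : q ^ (9 * tri r) = (q ^ 3) ^ tri r * (q ^ 3) ^ (r * r + r) := by
    rw [← zpow_natCast (q ^ 3) (r * r + r), ← zpow_add₀ (pow_ne_zero 3 q_ne_zero), ← zpow_natCast q 3,
      ← zpow_mul]
    congr 1
    have := two_mul_tri r
    push_cast
    linarith
  rw [e]
  ring

theorem summable_appell {b : ℤ} (hb0 : 0 ≤ b) (hb : b ≤ 2) :
    Summable fun k : ℤ => (-1 : K) ^ k * q ^ (3 * tri k + b * k) * geom 1 k :=
  summable_theta_mul_geom le_rfl hb0 hb

theorem geom_one_eq (k : ℤ) :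
    geom 1 k = cube (geom 1 k) * (1 + q * cube (q ^ k) + q ^ 2 * cube (q ^ (2 * k))) := by
  have h1 := one_sub_q_zpow_ne_zero (n := 3 * k + 1) (by omega)
  have h2 := one_sub_q_zpow_ne_zero (n := 3 * (3 * k + 1)) (by omega)
  rw [geom, map_inv₀, map_sub, map_one, cube_q_zpow, cube_q_zpow, cube_q_zpow,
    eq_comm, inv_mul_eq_iff_eq_mul₀ h2, eq_comm, mul_inv_eq_iff_eq_mul₀ h1]
  have e1 : q ^ (3 * (3 * k + 1)) = (q ^ (3 * k + 1)) ^ 3 := by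
    rw [← zpow_natCast, ← zpow_mul]; congr 1; push_cast; ring
  have e2 : q * q ^ (3 * k) = q ^ (3 * k + 1) := by
    rw [zpow_add₀ q_ne_zero, zpow_one, mul_comm]
  have e3 : q ^ 2 * q ^ (3 * (2 * k)) = (q ^ (3 * k + 1)) ^ 2 := by
    rw [← zpow_natCast, ← zpow_natCast, ← zpow_mul, ← zpow_add₀ q_ne_zero]; congr 1; push_cast; ring
  rw [e1, e2, e3]
  ring

theorem tsum_nine_tri :
    ∑' k : ℤ, (-1 : K) ^ k * q ^ (9 * tri k) * geom 1 k =
      cube (appell 0) + q * cube (appell 1) + q ^ 2 * cube (appell 2) := by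
  have h (b : ℤ) (hb0 : 0 ≤ b) (hb : b ≤ 2) :
      HasSum (fun k : ℤ => cube ((-1 : K) ^ k * q ^ (3 * tri k + b * k) * geom 1 k))
        (cube (appell b)) := (summable_appell hb0 hb).hasSum.map cube continuous_cube
  refine HasSum.tsum_eq (hasSum_of_forall_eq (((h 0 le_rfl (by norm_num)).add
    ((h 1 (by norm_num) (by norm_num)).mul_left q)).add
    ((h 2 (by norm_num) le_rfl).mul_left (q ^ 2))) fun k => ?_)
  conv_rhs => rw [geom_one_eq]
  have e : q ^ (9 * tri k) = cube (q ^ (3 * tri k)) := by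
    rw [cube_q_zpow]; congr 1; ring
  have em : (-1 : K) ^ k = cube ((-1 : K) ^ k) := by
    rw [map_zpow₀, map_neg, map_one]
  rw [e]
  conv_rhs => rw [em]
  simp only [zpow_add₀ q_ne_zero, map_mul, zero_mul, one_mul, zpow_zero, map_one]
  ring

/-- The parts of the mock theta function in the residue classes modulo three. -/
theorem dissect_beta_mul_euler :
    toK (dissect 1 mockThetaBeta) * euler = appell 0 ∧
      toK (dissect 2 mockThetaBeta) * euler = appell 1 := by
  have h := toK_mockThetaBeta_mul
  rw [tsum_nine_tri, toK_eq_sum_dissect] at h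
  have h2 := eq_zero_of_dissection
    -- The prefactor q shifts the classes: q · q² = q³ moves A_2 into class 0 with an extra q.
    (a := toK (dissect 0 mockThetaBeta) * euler - q * appell 2)
    (b := toK (dissect 1 mockThetaBeta) * euler - appell 0)
    (c := toK (dissect 2 mockThetaBeta) * euler - appell 1) (by
      simp only [map_sub, map_mul, cube_q]
      linear_combination h)
  exact ⟨sub_eq_zero.1 h2.2.1, sub_eq_zero.1 h2.2.2⟩

/-! ### Multiplication by a theta function: recurrences for the coefficients in z -/

theorem finite_abs_sub_lt (c D : ℤ) : {n : ℤ | |n| - c < D}.Finite := by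
  simpa only [sub_lt_iff_lt_add] using finite_abs_lt (D + c)

/-- The shear `(m, k) ↦ (m - k, k)`. -/
def shearEquiv : ℤ × ℤ ≃ ℤ × ℤ where
  toFun p := (p.1 - p.2, p.2)
  invFun p := (p.1 + p.2, p.2)
  left_inv p := by simp
  right_inv p := by simp

/-- The `m`-th coefficient of the product of the theta function with `∑ g k * z ^ k`. -/
noncomputable def thetaConv (g : ℤ → K) (m : ℤ) : K :=
  ∑' k : ℤ, (-1 : K) ^ (m - k) * q ^ (3 * tri (m - k - 1)) * g k

section ThetaConv

variable {g : ℤ → K} (hg : Summable fun k => q ^ k * g k)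

include hg

theorem hasSum_prod_thetaConv :
    HasSum (fun p : ℤ × ℤ => q ^ p.1 * ((-1 : K) ^ (p.1 - p.2) * q ^ (3 * tri (p.1 - p.2 - 1)) *
      g p.2)) (euler * ∑' k, q ^ k * g k) := by
  refine hasSum_of_forall_eq
    (shearEquiv.hasSum_iff.2 (hasSum_euler'.mul_of_nonarchimedean hg.hasSum)) fun p => ?_
  obtain ⟨m, k⟩ := p
  simp only [Function.comp_apply, shearEquiv, Equiv.coe_fn_mk]
  have e : q ^ (3 * tri (m - k) - 2 * (m - k)) * q ^ k = q ^ m * q ^ (3 * tri (m - k - 1)) := by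
    rw [← zpow_add₀ q_ne_zero, ← zpow_add₀ q_ne_zero, tri_sub_one]
    congr 1
    ring
  linear_combination (-1 : K) ^ (m - k) * g k * e

theorem summable_thetaConv (m : ℤ) :
    Summable fun k => (-1 : K) ^ (m - k) * q ^ (3 * tri (m - k - 1)) * g k := by
  have h := ((hasSum_prod_thetaConv hg).summable.prod_factor m).mul_left (q ^ m)⁻¹
  simpa only [inv_mul_cancel_left₀ (zpow_ne_zero m q_ne_zero)] using h

theorem hasSum_thetaConv :
    HasSum (fun m => q ^ m * thetaConv g m) (euler * ∑' k, q ^ k * g k) :=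
  HasSum.prod_fiberwise (g := fun m => q ^ m * thetaConv g m) (hasSum_prod_thetaConv hg) fun m => by
    simpa only [thetaConv] using (summable_thetaConv hg m).hasSum.mul_left (q ^ m)

/-- The coefficient form of the functional equation of θ(z) = ∑ (-1)^j q^(3 tri(j-1)) z^j under z ↦
q³z. It clears the denominator 1 - q^(3k+a) of a Lambert series; at z = q the theta function is E.
-/
theorem thetaConv_recurrence (a m : ℤ) :
    thetaConv g (m + 1) + q ^ (3 * m + a) * thetaConv g m =
      ∑' k : ℤ, (-1 : K) ^ (m + 1 - k) * q ^ (3 * tri (m - k)) * ((1 - q ^ (3 * k + a)) * g k) := by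
  rw [thetaConv, thetaConv, ← tsum_mul_left, ← (summable_thetaConv hg _).tsum_add
    ((summable_thetaConv hg m).mul_left _)]
  refine tsum_congr fun k => ?_
  have e1 : (-1 : K) ^ (m + 1 - k) = -(-1) ^ (m - k) := by
    rw [show m + 1 - k = m - k + 1 by ring, zpow_add₀ (by simp), zpow_one]; ring
  have e2 : q ^ (3 * m + a) * q ^ (3 * tri (m - k - 1)) =
      q ^ (3 * tri (m - k)) * q ^ (3 * k + a) := by
    rw [← zpow_add₀ q_ne_zero, ← zpow_add₀ q_ne_zero, tri_sub_one]
    congr 1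
    ring
  rw [e1, show m + 1 - k - 1 = m - k by ring]
  linear_combination (-1 : K) ^ (m - k) * g k * e2

end ThetaConv

theorem eq_of_homogeneous_recurrence {y : ℤ → K} {a : ℤ}
    (h : ∀ m, y (m + 1) + q ^ (3 * m + a) * y m = 0) (m : ℤ) :
    y m = (-1) ^ m * q ^ (3 * tri (m - 1) + a * m) * y 0 := by
  have hm : (-1 : K) ≠ 0 := by simp
  have hstep (i : ℤ) : (-1 : K) ^ (i + 1) * q ^ (3 * tri (i + 1 - 1) + a * (i + 1)) * y 0 +
      q ^ (3 * i + a) * ((-1) ^ i * q ^ (3 * tri (i - 1) + a * i) * y 0) = 0 := by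
    have e : q ^ (3 * tri (i + 1 - 1) + a * (i + 1)) =
        q ^ (3 * i + a) * q ^ (3 * tri (i - 1) + a * i) := by
      rw [add_sub_cancel_right, ← zpow_add₀ q_ne_zero, tri_sub_one]; congr 1; ring
    rw [e, zpow_add₀ hm, zpow_one]
    ring
  induction m using Int.induction_on with
  | zero => simp [show tri (-1) = 0 from rfl]
  | succ i ih =>
    have h1 := h i
    have h2 := hstep i
    rw [← ih] at h2
    linear_combination h1 - h2
  | pred i ih =>
    have h1 := h (-i - 1)
    have h2 := hstep (-i - 1)
    rw [sub_add_cancel] at h1 h2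
    rw [← ih] at h2
    have h3 : q ^ (3 * (-(i : ℤ) - 1) + a) ≠ 0 := zpow_ne_zero _ q_ne_zero
    apply mul_left_cancel₀ h3
    linear_combination h1 - h2

theorem summable_theta : Summable fun j : ℤ => (-1 : K) ^ j * q ^ (3 * tri j) := by
  refine summable_of_ordGE (fun k => |k| - 1) (finite_abs_sub_lt 1) fun k => ?_
  exact (ordGE_neg_one_zpow k).mul_left
    (ordGE_q_zpow (by linarith [abs_le_tri_add_one k, tri_nonneg k]))

theorem hasSum_theta : HasSum (fun j : ℤ => (-1 : K) ^ j * q ^ (3 * tri j)) 0 := by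
  have h : ∑' j : ℤ, (-1 : K) ^ j * q ^ (3 * tri j) = 0 := by
    rw [tsum_int_eq_tsum_nat summable_theta]
    refine (tsum_congr fun r => ?_).trans tsum_zero
    rw [neg_one_zpow_reflect, tri_neg_succ, zpow_natCast]
    ring
  exact h ▸ summable_theta.hasSum

theorem hasSum_theta_reflect (m : ℤ) :
    HasSum (fun k : ℤ => (-1 : K) ^ (m + 1 - k) * q ^ (3 * tri (m - k))) 0 := by
  have h := ((Equiv.subLeft m).hasSum_iff.2 hasSum_theta).neg
  rw [neg_zero] at h
  refine hasSum_of_forall_eq h fun k => ?_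
  rw [Function.comp_apply, Equiv.subLeft_apply, show m + 1 - k = m - k + 1 by ring,
    zpow_add₀ (by simp), zpow_one]
  ring

theorem ordGE_q_zpow_mul_geom {a : ℤ} (ha0 : 0 ≤ a) (ha : a ≤ 2) {k : ℤ} (h : 3 * k + a ≠ 0) :
    OrdGE (|k| - 2) (q ^ k * geom a k) := by
  rcases le_or_gt 0 k with hk | hk
  · rw [abs_of_nonneg hk]
    exact ((ordGE_q_zpow le_rfl).mul_right (ordGE_inv_one_sub_q_zpow h)).mono (by omega)
  · rw [abs_of_neg hk]
    exact ((ordGE_q_zpow le_rfl).mul (ordGE_inv_one_sub_q_zpow' h)).mono (by omega)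

theorem summable_q_zpow_mul_geom {a : ℤ} (ha0 : 1 ≤ a) (ha : a ≤ 2) :
    Summable fun k : ℤ => q ^ k * geom a k :=
  summable_of_ordGE (fun k => |k| - 2) (finite_abs_sub_lt 2) fun k =>
    ordGE_q_zpow_mul_geom (by omega) ha (by omega)

theorem summable_q_zpow_mul_intCast_mul_geom {a : ℤ} (ha0 : 0 ≤ a) (ha : a ≤ 2) (u : ℤ → ℤ) :
    Summable fun k : ℤ => q ^ k * (u k * geom a k) := by
  refine summable_of_ordGE (fun k => |k| - 2) (finite_abs_sub_lt 2) fun k => ?_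
  by_cases h : 3 * k + a = 0
  · rw [geom, h]; simpa using ordGE_zero _
  · rw [mul_left_comm]
    exact (ordGE_intCast _).mul_left (ordGE_q_zpow_mul_geom ha0 ha h)

/-- Once the denominator is cleared, the right side is the theta function at one of its zeros, so
the recurrence is homogeneous and the zeroth coefficient determines all others. -/
theorem thetaConv_geom {a : ℤ} (ha0 : 1 ≤ a) (ha : a ≤ 2) (m : ℤ) :
    thetaConv (geom a) m = (-1) ^ m * q ^ (3 * tri (m - 1) + a * m) * thetaConv (geom a) 0 := by
  refine eq_of_homogeneous_recurrence (fun m => ?_) m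
  rw [thetaConv_recurrence (summable_q_zpow_mul_geom ha0 ha)]
  have h (k : ℤ) : (1 - q ^ (3 * k + a)) * geom a k = 1 :=
    mul_inv_cancel₀ (one_sub_q_zpow_ne_zero (by omega))
  simp_rw [h, mul_one]
  exact (hasSum_theta_reflect m).tsum_eq

theorem tsum_q_zpow_mul_geom_one : ∑' k : ℤ, q ^ k * geom 1 k = appell 0 := by
  have h1 := hasSum_thetaConv (summable_q_zpow_mul_geom (a := 1) le_rfl (by norm_num))
  have h2 := hasSum_euler.mul_right (thetaConv (geom 1) 0)
  have h3 := h1.unique (hasSum_of_forall_eq h2 fun m => by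
    rw [thetaConv_geom le_rfl (by norm_num) m, tri_sub_one]
    have e : q ^ (3 * tri m - m) = q ^ m * q ^ (3 * (tri m - m) + 1 * m) := by
      rw [← zpow_add₀ q_ne_zero]; congr 1; ring
    rw [e]; ring)
  rw [mul_left_cancel₀ euler_ne_zero h3, thetaConv, appell]
  refine tsum_congr fun k => ?_
  rw [show 0 - k - 1 = -1 - k by ring, tri_reflect, zero_sub, zpow_neg, zero_mul, add_zero]
  rcases Int.even_or_odd k with h | h <;> simp [h.neg_one_zpow]

/-- For a = 1 the solved coefficients resum to E; for a = 2 they resum to a theta series that is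
zero. -/
theorem tsum_q_zpow_mul_geom_two : ∑' k : ℤ, q ^ k * geom 2 k = 0 := by
  have h1 := hasSum_thetaConv (summable_q_zpow_mul_geom (a := 2) (by norm_num) le_rfl)
  have h2 := hasSum_theta.mul_right (thetaConv (geom 2) 0)
  have h3 := h1.unique (hasSum_of_forall_eq h2 fun m => by
    rw [thetaConv_geom (by norm_num) le_rfl m, tri_sub_one]
    have e : q ^ (3 * tri m) = q ^ m * q ^ (3 * (tri m - m) + 2 * m) := by
      rw [← zpow_add₀ q_ne_zero]; congr 1; ring
    rw [e]; ring)
  rw [zero_mul] at h3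
  exact (mul_eq_zero.1 h3).resolve_left euler_ne_zero

/-! ### The square of A_0 as a Lambert series -/

/-- The indicator function of the nonnegative integers. -/
noncomputable def nonnegInd (k : ℤ) : K := if 0 ≤ k then 1 else 0

theorem summable_geom_sub_nonnegInd : Summable fun k : ℤ => geom 1 k - nonnegInd k := by
  refine summable_of_ordGE (fun k => |k| - 2) (finite_abs_sub_lt 2) fun k => ?_
  rcases le_or_gt 0 k with hk | hk
  · have h := one_sub_q_zpow_ne_zero (n := 3 * k + 1) (by omega)
    have e : geom 1 k - nonnegInd k = q ^ (3 * k + 1) * geom 1 k := by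
      rw [nonnegInd, if_pos hk, geom]; field_simp; ring
    rw [e, abs_of_nonneg hk]
    exact ((ordGE_q_zpow le_rfl).mul_right (ordGE_inv_one_sub_q_zpow (by omega))).mono (by omega)
  · rw [nonnegInd, if_neg (by omega), sub_zero, abs_of_neg hk]
    exact (ordGE_inv_one_sub_q_zpow' (n := 3 * k + 1) (by omega)).mono (by omega)

theorem hasSum_nonnegInd (m : ℤ) :
    HasSum (fun k => nonnegInd k + nonnegInd (m - k) - 1) ((m : K) + 1) := by
  induction m using Int.induction_on with
  | zero =>
    have h := hasSum_ite_eq (0 : ℤ) (1 : K)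
    simp only [Int.cast_zero, zero_add, zero_sub]
    refine hasSum_of_forall_eq h fun k => ?_
    unfold nonnegInd
    rcases lt_trichotomy k 0 with hk | hk | hk
    · rw [if_neg (by omega), if_neg (by omega), if_pos (by omega)]; ring
    · rw [if_pos hk, if_pos (by omega), if_pos (by omega)]; ring
    · rw [if_neg (by omega), if_pos (by omega), if_neg (by omega)]; ring
  | succ i ih =>
    have h := ih.add (hasSum_ite_eq ((i : ℤ) + 1) (1 : K))
    rw [show (((i : ℤ) + 1 : ℤ) : K) + 1 = ((i : ℤ) : K) + 1 + 1 by push_cast; ring]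
    refine hasSum_of_forall_eq h fun k => ?_
    have e : nonnegInd ((i : ℤ) + 1 - k) = nonnegInd (i - k) + if k = (i : ℤ) + 1 then 1 else 0 := by
      unfold nonnegInd
      split_ifs <;> first | omega | simp
    rw [e]; ring
  | pred i ih =>
    have h := ih.sub (hasSum_ite_eq (-(i : ℤ)) (1 : K))
    rw [show ((-(i : ℤ) - 1 : ℤ) : K) + 1 = ((-(i : ℤ) : ℤ) : K) + 1 - 1 by push_cast; ring]
    refine hasSum_of_forall_eq h fun k => ?_
    have e : nonnegInd (-(i : ℤ) - k) = nonnegInd (-(i : ℤ) - 1 - k) + if k = -(i : ℤ) then 1 else 0 := by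
      unfold nonnegInd
      split_ifs <;> first | omega | simp
    rw [e]; ring

theorem geom_mul_geom (m k : ℤ) :
    geom 1 k * geom 1 (m - k) = geom 2 m * (geom 1 k + geom 1 (m - k) - 1) := by
  have h1 := one_sub_q_zpow_ne_zero (n := 3 * k + 1) (by omega)
  have h2 := one_sub_q_zpow_ne_zero (n := 3 * (m - k) + 1) (by omega)
  have h3 := one_sub_q_zpow_ne_zero (n := 3 * m + 2) (by omega)
  have e : q ^ (3 * m + 2) = q ^ (3 * k + 1) * q ^ (3 * (m - k) + 1) := by
    rw [← zpow_add₀ q_ne_zero]; congr 1; ring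
  unfold geom
  rw [e] at h3 ⊢
  clear e
  generalize q ^ (3 * k + 1) = x at *
  generalize q ^ (3 * (m - k) + 1) = y at *
  field_simp
  ring

/-- The series `∑ (3 m + c) q ^ m / (1 - q ^ (3 m + c))`. -/
noncomputable def lambert (c : ℤ) : K :=
  ∑' m : ℤ, q ^ m * (((3 * m + c : ℤ) : K) * geom c m)

/-- Square ∑ q^k / (1 - q^(3k+1)) and collect q^m by `geom_mul_geom`. The sum over k of the bracket
converges only as a whole; subtracting indicators of k ≥ 0 evaluates it as 2H + m + 1 with H
independent of m. -/
theorem lambert_two : lambert 2 = 3 * appell 0 ^ 2 := by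
  have hK := summable_q_zpow_mul_geom (a := 1) le_rfl (by norm_num)
  have hprod := shearEquiv.hasSum_iff.2 (hK.hasSum.mul_of_nonarchimedean hK.hasSum)
  rw [tsum_q_zpow_mul_geom_one] at hprod
  set H := ∑' k : ℤ, (geom 1 k - nonnegInd k) with hH
  have hH1 := summable_geom_sub_nonnegInd.hasSum
  rw [← hH] at hH1
  have hsq := hprod.prod_fiberwise (g := fun m => q ^ m * geom 2 m * (H + H + ((m : K) + 1)))
    fun m => by
      have h := ((hH1.add ((Equiv.subLeft m).hasSum_iff.2 hH1)).add (hasSum_nonnegInd m)).mul_left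
        (q ^ m * geom 2 m)
      refine hasSum_of_forall_eq h fun k => ?_
      simp only [Function.comp_apply, shearEquiv, Equiv.coe_fn_mk, Equiv.subLeft_apply]
      have e : q ^ (m - k) * q ^ k = q ^ m := by
        rw [← zpow_add₀ q_ne_zero, sub_add_cancel]
      linear_combination (-q ^ m) * geom_mul_geom m k - geom 1 k * geom 1 (m - k) * e
  have h2 := (summable_q_zpow_mul_geom (a := 2) (by norm_num) le_rfl).hasSum
  rw [tsum_q_zpow_mul_geom_two] at h2
  -- Multiples of the vanishing sum ∑ q^m / (1 - q^(3m+2)) are free, and 3(2H + m + 1) - (6H + 1) =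
  -- 3m + 2.
  have h3 := (hsq.mul_left 3).sub (h2.mul_left (6 * H + 1))
  rw [mul_zero, sub_zero] at h3
  rw [lambert, pow_two]
  refine (hasSum_of_forall_eq h3 fun m => ?_).tsum_eq
  push_cast
  ring

/-! ### A_1 through its coefficients in z, compared with ∑ k q^k / (1 - q^(3k)) -/

theorem hasSum_pow_of_ordGE {t : K} (ht : OrdGE 1 t) : HasSum (fun n : ℕ => t ^ n) (1 - t)⁻¹ := by
  have hs : Summable fun n : ℕ => t ^ n :=
    summable_of_ordGE (fun n : ℕ => (n : ℤ)) finite_natCast_lt ht.pow_natCast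
  rw [← eq_inv_of_mul_eq_one_left hs.tsum_pow_mul_one_sub]
  exact hs.hasSum

/-- The sign `1` if both arguments are nonnegative, `-1` if both are negative, else `0`. -/
noncomputable def quadrantSign (r k : ℤ) : K :=
  if 0 ≤ r then if 0 ≤ k then 1 else 0 else if 0 ≤ k then 0 else -1

theorem quadrantSign_sub (r k : ℤ) :
    quadrantSign r k - quadrantSign (r - 1) k = if r = 0 then 1 else 0 := by
  unfold quadrantSign
  split_ifs <;> first | omega | simp

theorem hasSum_quadrantSign_mul (r : ℤ) :
    HasSum (fun k : ℤ => quadrantSign r k * (q ^ (3 * r + 1)) ^ k) (geom 1 r) := by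
  rcases le_or_gt 0 r with hr | hr
  · have h := hasSum_pow_of_ordGE (ordGE_q_zpow (n := 3 * r + 1) (D := 1) (by omega))
    rw [geom, ← Function.Injective.hasSum_iff (g := fun n : ℕ => (n : ℤ)) Nat.cast_injective]
    · refine hasSum_of_forall_eq h fun n => ?_
      simp [quadrantSign, hr]
    · intro k hk
      have : ¬ 0 ≤ k := fun h => hk ⟨k.toNat, by simpa using h⟩
      simp [quadrantSign, hr, this]
  · have h := (hasSum_pow_of_ordGE
      (ordGE_q_zpow (n := -(3 * r + 1)) (D := 1) (by omega))).mul_left (-q ^ (-(3 * r + 1)))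
    rw [geom, show 3 * r + 1 = -(-(3 * r + 1)) by ring, inv_one_sub_q_zpow_neg (by omega), neg_neg,
      ← neg_mul, ← Function.Injective.hasSum_iff (g := fun n : ℕ => -1 - (n : ℤ))
        fun a b hab => by simpa using hab]
    · refine hasSum_of_forall_eq h fun n => ?_
      have h1 : ¬ 0 ≤ r := by omega
      have h2 : ¬ 0 ≤ -1 - (n : ℤ) := by omega
      have e : (q ^ (3 * r + 1)) ^ (-1 - (n : ℤ)) = q ^ (-(3 * r + 1)) * (q ^ (-(3 * r + 1))) ^ n := by
        rw [← zpow_natCast, ← zpow_mul, ← zpow_mul, ← zpow_add₀ q_ne_zero]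
        congr 1
        ring
      rw [Function.comp_apply, e, quadrantSign, if_neg h1, if_neg h2]
      ring
    · intro k hk
      have : 0 ≤ k := by
        by_contra h
        exact hk ⟨(-1 - k).toNat, by simp only; omega⟩
      have h1 : ¬ 0 ≤ r := by omega
      simp [quadrantSign, h1, this]

/-- The coefficients of `∑ (-1) ^ r Q ^ (r (r + 1) / 2) z ^ (r + 1) / (1 - z Q ^ r)`, `Q = q ^ 3`. -/
noncomputable def appellCoeff (m : ℤ) : K :=
  ∑' r : ℤ, quadrantSign r (m - 1 - r) * ((-1 : K) ^ r * q ^ (3 * (tri r + r * (m - 1 - r))))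

theorem hasSum_prod_appell :
    HasSum (fun p : ℤ × ℤ => quadrantSign p.1 p.2 *
      ((-1 : K) ^ p.1 * q ^ (3 * tri p.1 + p.1 + 1 + (3 * p.1 + 1) * p.2))) (q * appell 1) := by
  have hs : Summable (fun p : ℤ × ℤ => quadrantSign p.1 p.2 *
      ((-1 : K) ^ p.1 * q ^ (3 * tri p.1 + p.1 + 1 + (3 * p.1 + 1) * p.2))) := by
    refine summable_of_ordGE (fun p : ℤ × ℤ => |p.1| + |p.2| - 2) (fun D => by
      simpa only [sub_lt_iff_lt_add] using finite_abs_add_abs_lt (D + 2)) fun ⟨r, k⟩ => ?_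
    have ht := tri_nonneg r
    simp only
    unfold quadrantSign
    split_ifs with h1 h2 h2
    · rw [one_mul, abs_of_nonneg h1, abs_of_nonneg h2]
      refine (ordGE_neg_one_zpow r).mul_left (ordGE_q_zpow ?_)
      nlinarith [mul_nonneg h1 h2]
    · rw [zero_mul]; exact ordGE_zero _
    · rw [zero_mul]; exact ordGE_zero _
    · rw [abs_of_neg (by omega), abs_of_neg (by omega)]
      refine ordGE_one.neg.mul_left ((ordGE_neg_one_zpow r).mul_left (ordGE_q_zpow ?_))
      nlinarith [mul_nonneg (show 0 ≤ -1 - r by omega) (show 0 ≤ -1 - k by omega)]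
  have hfib (r : ℤ) := (hasSum_quadrantSign_mul r).mul_left
    (q * ((-1 : K) ^ r * q ^ (3 * tri r + 1 * r)))
  have hsum := hs.hasSum.prod_fiberwise
    (g := fun r => q * ((-1 : K) ^ r * q ^ (3 * tri r + 1 * r)) * geom 1 r) fun r => by
      refine hasSum_of_forall_eq (hfib r) fun k => ?_
      have e : q ^ (3 * tri r + r + 1 + (3 * r + 1) * k) =
          q * q ^ (3 * tri r + 1 * r) * (q ^ (3 * r + 1)) ^ k := by
        rw [← zpow_mul, ← zpow_one_add₀ q_ne_zero, ← zpow_add₀ q_ne_zero]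
        congr 1
        ring
      rw [e]
      ring
  have h2 : q * appell 1 = ∑' p : ℤ × ℤ, quadrantSign p.1 p.2 *
      ((-1 : K) ^ p.1 * q ^ (3 * tri p.1 + p.1 + 1 + (3 * p.1 + 1) * p.2)) := by
    rw [← hsum.tsum_eq, appell, ← tsum_mul_left]
    simp only [mul_assoc]
  rw [h2]
  exact hs.hasSum

/-- The change of variables `(m, r) ↦ (r, m - 1 - r)`. -/
def antidiagEquiv : ℤ × ℤ ≃ ℤ × ℤ where
  toFun p := (p.2, p.1 - 1 - p.2)
  invFun p := (p.1 + p.2 + 1, p.1)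
  left_inv p := by ext <;> simp
  right_inv p := by ext <;> simp

theorem hasSum_prod_appellCoeff :
    HasSum (fun p : ℤ × ℤ => q ^ p.1 * (quadrantSign p.2 (p.1 - 1 - p.2) *
      ((-1 : K) ^ p.2 * q ^ (3 * (tri p.2 + p.2 * (p.1 - 1 - p.2)))))) (q * appell 1) := by
  refine hasSum_of_forall_eq (antidiagEquiv.hasSum_iff.2 hasSum_prod_appell) fun ⟨m, r⟩ => ?_
  simp only [Function.comp_apply, antidiagEquiv, Equiv.coe_fn_mk]
  have e : q ^ (3 * tri r + r + 1 + (3 * r + 1) * (m - 1 - r)) =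
      q ^ m * q ^ (3 * (tri r + r * (m - 1 - r))) := by
    rw [← zpow_add₀ q_ne_zero]
    congr 1
    ring
  rw [e]
  ring

theorem summable_appellCoeff (m : ℤ) : Summable fun r : ℤ => quadrantSign r (m - 1 - r) *
    ((-1 : K) ^ r * q ^ (3 * (tri r + r * (m - 1 - r)))) := by
  have h := (hasSum_prod_appellCoeff.summable.prod_factor m).mul_left (q ^ m)⁻¹
  simpa only [inv_mul_cancel_left₀ (zpow_ne_zero m q_ne_zero)] using h

theorem hasSum_appellCoeff : HasSum (fun m => q ^ m * appellCoeff m) (q * appell 1) :=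
  HasSum.prod_fiberwise (g := fun m => q ^ m * appellCoeff m) hasSum_prod_appellCoeff fun m => by
    simpa only [appellCoeff] using (summable_appellCoeff m).hasSum.mul_left (q ^ m)

/-- Shifting r by one in the second sum aligns the exponents, and the difference of quadrant signs
survives only at r = 0. -/
theorem appellCoeff_recurrence (m : ℤ) :
    appellCoeff (m + 1) + q ^ (3 * m) * appellCoeff m = 1 := by
  have h1 := (summable_appellCoeff (m + 1)).hasSum
  have h2 := (((Equiv.subRight (1 : ℤ)).hasSum_iff.2 (summable_appellCoeff m).hasSum)).mul_left
    (q ^ (3 * m))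
  have h3 := hasSum_ite_eq (0 : ℤ) (1 : K)
  refine (h1.add h2).unique (hasSum_of_forall_eq h3 fun r => ?_)
  simp only [Function.comp_apply, Equiv.subRight_apply]
  have e1 : m + 1 - 1 - r = m - 1 - (r - 1) := by ring
  have hq : q ^ (3 * m) * q ^ (3 * (tri (r - 1) + (r - 1) * (m - 1 - (r - 1)))) =
      q ^ (3 * (tri r + r * (m - 1 - (r - 1)))) := by
    rw [← zpow_add₀ q_ne_zero, tri_sub_one]
    congr 1
    ring
  have hm : (-1 : K) ^ (r - 1) = -(-1) ^ r := by
    have h : (-1 : K) ^ (r - 1 + 1) = (-1) ^ (r - 1) * (-1) := zpow_add_one₀ (by simp) _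
    rw [sub_add_cancel] at h
    linear_combination h
  have hs := quadrantSign_sub r (m - 1 - (r - 1))
  have hz : (if r = 0 then (1 : K) else 0) = (if r = 0 then (1 : K) else 0) *
      ((-1) ^ r * q ^ (3 * (tri r + r * (m - 1 - (r - 1))))) := by
    split_ifs with h
    · subst h; simp [tri_zero]
    · rw [zero_mul]
  rw [e1, hm, hz, ← hs, ← hq]
  ring

theorem appellCoeff_zero : appellCoeff 0 = 0 := by
  refine (tsum_congr fun r => ?_).trans tsum_zero
  unfold quadrantSign
  split_ifs <;> first | omega | simp

theorem thetaConv_lambert_recurrence (m : ℤ) :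
    thetaConv (fun k => (k : K) * geom 0 k) (m + 1) +
      q ^ (3 * m) * thetaConv (fun k => (k : K) * geom 0 k) m = cube euler ^ 3 := by
  have hs := summable_q_zpow_mul_intCast_mul_geom (a := 0) le_rfl (by norm_num) fun k => k
  have h := thetaConv_recurrence hs 0 m
  rw [add_zero] at h
  rw [h]
  -- At k = 0 the convention 0⁻¹ = 0 is harmless, because the weight k vanishes there too.
  have hk (k : ℤ) : (1 - q ^ (3 * k + 0)) * ((k : K) * geom 0 k) = k := by
    by_cases h0 : k = 0
    · simp [h0]
    · rw [mul_left_comm, geom, mul_inv_cancel₀ (one_sub_q_zpow_ne_zero (by omega)), mul_one]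
  simp_rw [hk]
  have h1 := hasSum_euler_cubed_int.map cube continuous_cube
  rw [map_pow] at h1
  -- Write k = m - j: the part with weight j is Jacobi's identity at q³, and the part with weight m
  -- is m times a zero theta series.
  have h2 := ((Equiv.subLeft m).hasSum_iff.2 h1).add ((hasSum_theta_reflect m).mul_left (m : K))
  rw [mul_zero, add_zero] at h2
  refine (hasSum_of_forall_eq h2 fun k => ?_).tsum_eq
  simp only [Function.comp_apply, Equiv.subLeft_apply, map_mul, map_zpow₀, map_neg, map_one,
    map_intCast]
  rw [← map_zpow₀, cube_q_zpow, show m + 1 - k = m - k + 1 by ring, zpow_add₀ (by simp), zpow_one]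
  push_cast
  ring

theorem thetaConv_lambert_zero :
    ∃ Y : K, thetaConv (fun k => (k : K) * geom 0 k) 0 = cube Y := by
  have hs : Summable fun k : ℤ => (-1 : K) ^ (0 - k) * q ^ tri (0 - k - 1) *
      ((k : K) * (1 - q ^ k)⁻¹) := by
    refine summable_of_ordGE (fun k => |k| - 1) (finite_abs_sub_lt 1) fun k => ?_
    refine ((ordGE_neg_one_zpow _).mul_left (ordGE_q_zpow ?_)).mul_right
      ((ordGE_intCast k).mul_left ?_)
    · rw [show 0 - k - 1 = -1 - k by ring, tri_reflect]
      linarith [abs_le_tri_add_one k]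
    · by_cases h0 : k = 0
      · simpa [h0] using ordGE_zero 0
      · exact ordGE_inv_one_sub_q_zpow h0
  refine ⟨_, (hasSum_of_forall_eq (hs.hasSum.map cube continuous_cube) fun k => ?_).tsum_eq⟩
  simp only [Function.comp_apply, map_mul, map_inv₀, map_sub, map_one, map_intCast, cube_q_zpow]
  rw [map_zpow₀, map_neg, map_one, geom, add_zero]

/-- The series `∑ k q ^ k / (1 - q ^ (3 k))`. -/
noncomputable def lambertTotal : K := ∑' k : ℤ, q ^ k * ((k : K) * geom 0 k)

/-- Both coefficient sequences satisfy the same recurrence, with right sides E(q³)³ and 1. Hence y -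
E(q³)³ · `appellCoeff` is homogeneous and resums at z = q to E times its zeroth value, which is a
series in q³. -/
theorem exists_cube_euler_cubed_mul_appell :
    ∃ Y : K, cube euler ^ 3 * (q * appell 1) = euler * (lambertTotal - cube Y) := by
  obtain ⟨Y, hY⟩ := thetaConv_lambert_zero
  refine ⟨Y, ?_⟩
  set y := thetaConv (fun k => (k : K) * geom 0 k) with hy
  let d : ℤ → K := fun m => y m - cube euler ^ 3 * appellCoeff m
  have hd (m : ℤ) : d (m + 1) + q ^ (3 * m + 0) * d m = 0 := by
    have h1 := thetaConv_lambert_recurrence m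
    have h2 := appellCoeff_recurrence m
    rw [← hy] at h1
    simp only [d, add_zero]
    linear_combination h1 - cube euler ^ 3 * h2
  have h1 := hasSum_thetaConv
    (summable_q_zpow_mul_intCast_mul_geom (a := 0) le_rfl (by norm_num) fun k => k)
  rw [← hy] at h1
  have h2 := h1.sub (hasSum_appellCoeff.mul_left (cube euler ^ 3))
  have h3 := hasSum_euler'.mul_right (d 0)
  have h4 := h2.unique (hasSum_of_forall_eq h3 fun m => by
    have h5 := eq_of_homogeneous_recurrence hd m
    have e : q ^ (3 * tri m - 2 * m) = q ^ m * q ^ (3 * tri (m - 1) + 0 * m) := by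
      rw [← zpow_add₀ q_ne_zero, tri_sub_one]; congr 1; ring
    rw [e]
    simp only [d] at h5 ⊢
    linear_combination -q ^ m * h5)
  have h0 : d 0 = cube Y := by
    simp only [d]
    rw [hY, appellCoeff_zero, mul_zero, sub_zero]
  rw [h0] at h4
  rw [lambertTotal]
  linear_combination -h4

/-! ### The two product formulas -/

theorem hasSum_residue {F : ℤ → K} {c : ℤ} {a : K} (h : HasSum (fun m : ℤ => F (3 * m + c)) a) :
    HasSum (fun k => if 3 ∣ k - c then F k else 0) a := by
  rw [← Function.Injective.hasSum_iff (g := fun m : ℤ => 3 * m + c) fun x y hxy => by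
    simpa using hxy]
  · refine hasSum_of_forall_eq h fun m => ?_
    rw [Function.comp_apply, if_pos (by omega)]
  · intro k hk
    rw [if_neg]
    rintro ⟨m, hm⟩
    exact hk ⟨m, by simp only; omega⟩

theorem lambertTotal_eq :
    lambertTotal = cube (lambert 0) + q * cube (lambert 1) + q ^ 2 * cube (lambert 2) := by
  have h (c : ℤ) (hc0 : 0 ≤ c) (hc : c ≤ 2) :
      HasSum (fun k => if 3 ∣ k - c then q ^ k * ((k : K) * geom 0 k) else 0)
        (q ^ c * cube (lambert c)) := by
    refine hasSum_residue ?_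
    have h1 := (summable_q_zpow_mul_intCast_mul_geom hc0 hc fun m => 3 * m + c).hasSum.map
      cube continuous_cube
    refine hasSum_of_forall_eq (h1.mul_left (q ^ c)) fun m => ?_
    simp only [Function.comp_apply, map_mul, map_intCast, geom, map_inv₀, map_sub, map_one,
      cube_q_zpow]
    rw [zpow_add₀ q_ne_zero, add_zero]
    ring
  have h0 := h 0 le_rfl (by norm_num)
  have h1 := h 1 (by norm_num) (by norm_num)
  have h2 := h 2 (by norm_num) le_rfl
  rw [zpow_zero, one_mul] at h0
  rw [zpow_one] at h1
  rw [zpow_ofNat] at h2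
  refine (hasSum_of_forall_eq ((h0.add h1).add h2) fun k => ?_).tsum_eq
  obtain h3 | h3 | h3 : k % 3 = 0 ∨ k % 3 = 1 ∨ k % 3 = 2 := by omega
  · rw [if_pos (by omega), if_neg (by omega), if_neg (by omega)]; ring
  · rw [if_neg (by omega), if_pos (by omega), if_neg (by omega)]; ring
  · rw [if_neg (by omega), if_neg (by omega), if_pos (by omega)]; ring

/-- The part of the mock theta function in the residue class of five modulo nine. -/
theorem dissect_dissect_beta_mul_euler_cubed :
    toK (dissect 1 (dissect 2 mockThetaBeta)) * euler ^ 3 = 3 * appell 0 ^ 2 := by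
  obtain ⟨Y, hY⟩ := exists_cube_euler_cubed_mul_appell
  rw [← dissect_beta_mul_euler.2, toK_eq_sum_dissect (dissect 2 mockThetaBeta)] at hY
  generalize toK (dissect 1 (dissect 2 mockThetaBeta)) = b1 at *
  generalize toK (dissect 0 (dissect 2 mockThetaBeta)) = b0 at *
  generalize toK (dissect 2 (dissect 2 mockThetaBeta)) = b2 at *
  have h2 : cube euler ^ 3 * (q * (cube b0 + q * cube b1 + q ^ 2 * cube b2)) =
      lambertTotal - cube Y := mul_left_cancel₀ euler_ne_zero (by linear_combination hY)
  rw [lambertTotal_eq] at h2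
  -- Only class 2 is used; the unknown `Y` sits in class 0.
  have h3 := eq_zero_of_dissection
    (a := euler ^ 3 * q * b2 - lambert 0 + Y)
    (b := euler ^ 3 * b0 - lambert 1)
    (c := b1 * euler ^ 3 - lambert 2) (by
      simp only [map_sub, map_add, map_mul, map_pow, cube_q]
      linear_combination h2)
  rw [← lambert_two]
  exact sub_eq_zero.1 h3.2.2

/-- The generating function of the coefficients of index `3 n + 1`. -/
theorem dissect_one_beta :
    dissect 1 mockThetaBeta * PowerSeries.pentagonalSeries ℤ ^ 2 =
      PowerSeries.expand 3 three_ne_zero (PowerSeries.pentagonalSeries ℤ) ^ 3 := by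
  apply toK_injective
  rw [map_mul, map_pow, map_pow, ← cube_toK]
  change _ * euler ^ 2 = cube euler ^ 3
  rw [← appell_zero_mul_euler, ← dissect_beta_mul_euler.1]
  ring

/-- The generating function of the coefficients of index `9 n + 5`. -/
theorem dissect_five_beta :
    dissect 1 (dissect 2 mockThetaBeta) * PowerSeries.pentagonalSeries ℤ ^ 5 =
      3 * PowerSeries.expand 3 three_ne_zero (PowerSeries.pentagonalSeries ℤ) ^ 6 := by
  apply toK_injective
  rw [map_mul, map_mul, map_pow, map_pow, ← cube_toK, map_ofNat]
  change _ * euler ^ 5 = 3 * cube euler ^ 6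
  linear_combination euler ^ 2 * dissect_dissect_beta_mul_euler_cubed +
    3 * (appell 0 * euler + cube euler ^ 3) * appell_zero_mul_euler

/-! ### Congruences modulo 5 and 3 -/

instance : Fact (Nat.Prime 5) := ⟨Nat.prime_five⟩

theorem pow_five_eq_expand (f : (ZMod 5)⟦X⟧) :
    f ^ 5 = PowerSeries.expand 5 (by norm_num) f := by
  have h := MvPowerSeries.map_frobenius_expand (R := ZMod 5) 5 (by norm_num) (f := f)
  rw [ZMod.frobenius_zmod] at h
  exact h.symm.trans (by rw [MvPowerSeries.map_id]; rfl)

theorem coeff_mul_expand_five {g : (ZMod 5)⟦X⟧} (h : (ZMod 5)⟦X⟧) {n : ℕ}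
    (hg : ∀ i, i % 5 = n % 5 → PowerSeries.coeff i g = 0) :
    PowerSeries.coeff n (g * PowerSeries.expand 5 (by norm_num) h) = 0 := by
  rw [PowerSeries.coeff_mul]
  refine Finset.sum_eq_zero fun p hp => ?_
  rw [Finset.HasAntidiagonal.mem_antidiagonal] at hp
  by_cases h5 : 5 ∣ p.2
  · rw [hg p.1 (by omega), zero_mul]
  · rw [PowerSeries.coeff_expand_of_not_dvd _ _ _ h5, mul_zero]

theorem constantCoeff_pentagonalSeries :
    PowerSeries.constantCoeff (PowerSeries.pentagonalSeries ℤ) = 1 := by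
  have h := PowerSeries.coeff_pentagonalSeries_pentagonal ℤ 0
  simpa [pentagonal_def] using h

theorem exists_pentagonalSeries_mul_eq_one : ∃ g, PowerSeries.pentagonalSeries ℤ * g = 1 :=
  ⟨_, PowerSeries.mul_invOfUnit _ 1 (by simp [constantCoeff_pentagonalSeries])⟩

theorem hasSum_pentagonalSeries_cubed :
    HasSum (fun r : ℕ => (PowerSeries.C (((-1) ^ r * (2 * r + 1) : ℤ))) *
      (PowerSeries.X : ℤ⟦X⟧) ^ (tri r).toNat) (PowerSeries.pentagonalSeries ℤ ^ 3) := by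
  have hs : Summable (fun r : ℕ => (PowerSeries.C (((-1) ^ r * (2 * r + 1) : ℤ))) *
      (PowerSeries.X : ℤ⟦X⟧) ^ (tri r).toNat) := by
    rw [PowerSeries.WithPiTopology.summable_iff_summable_coeff]
    intro d
    refine summable_of_ne_finset_zero (s := Finset.range (d + 1)) fun r hr => ?_
    rw [Finset.mem_range] at hr
    have := self_le_tri (x := r)
    rw [PowerSeries.coeff_C_mul, PowerSeries.coeff_X_pow, if_neg (by omega), mul_zero]
  have h := hs.hasSum.map toK continuous_toK
  have h2 := h.unique (hasSum_of_forall_eq hasSum_euler_cubed fun r => by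
    have e : q ^ tri r = q ^ (tri r).toNat := by
      rw [← zpow_natCast, Int.toNat_of_nonneg (tri_nonneg r)]
    rw [Function.comp_apply, map_mul, map_pow, toK_X, e,
      show (PowerSeries.C ((-1) ^ r * (2 * (r : ℤ) + 1)) : ℤ⟦X⟧) =
        (((-1) ^ r * (2 * (r : ℤ) + 1) : ℤ) : ℤ⟦X⟧) from
        map_intCast (PowerSeries.C (R := ℤ)) ((-1) ^ r * (2 * (r : ℤ) + 1)), map_intCast]
    push_cast
    ring)
  rw [euler, ← map_pow] at h2
  rw [← toK_injective h2]
  exact hs.hasSum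

theorem five_dvd_coeff_pentagonalSeries_cubed {n : ℕ} (h0 : n % 5 ≠ 0) (h1 : n % 5 ≠ 1) :
    5 ∣ PowerSeries.coeff n (PowerSeries.pentagonalSeries ℤ ^ 3) := by
  have h := PowerSeries.WithPiTopology.hasSum_iff_hasSum_coeff ℤ |>.1 hasSum_pentagonalSeries_cubed n
  refine (isClosed_discrete {x : ℤ | 5 ∣ x}).mem_of_tendsto h
    (Eventually.of_forall fun s => Finset.dvd_sum fun r _ => ?_)
  rw [PowerSeries.coeff_C_mul, PowerSeries.coeff_X_pow]
  split_ifs with hn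
  · rw [mul_one]
    refine Dvd.dvd.mul_left ?_ _
    have ht := two_mul_tri r
    have hnn := tri_nonneg r
    have hm : ((r : ℤ) % 5 = 0 ∨ (r : ℤ) % 5 = 1 ∨ (r : ℤ) % 5 = 2 ∨ (r : ℤ) % 5 = 3 ∨
      (r : ℤ) % 5 = 4) := by omega
    have h2 : (2 * tri r) % 5 = ((r : ℤ) % 5 * ((r : ℤ) % 5 + 1)) % 5 := by
      rw [ht]; simp [Int.mul_emod, Int.add_emod]
    -- Triangular numbers are 0, 1 or 3 mod 5, and 3 forces r ≡ 2, where the weight 2r + 1 is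
    -- divisible by 5.
    rcases hm with hm | hm | hm | hm | hm <;> rw [hm] at h2 <;> omega
  · simp

theorem pentagonal_mod_five (k : ℤ) : pentagonal k % 5 ≤ 2 := by
  have ht := two_mul_natCast_pentagonal k
  have hm : k % 5 = 0 ∨ k % 5 = 1 ∨ k % 5 = 2 ∨ k % 5 = 3 ∨ k % 5 = 4 := by omega
  have h2 : (2 * (pentagonal k : ℤ)) % 5 = (k % 5 * (3 * (k % 5) - 1)) % 5 := by
    rw [ht]; simp [Int.mul_emod, Int.sub_emod]
  rcases hm with hm | hm | hm | hm | hm <;> rw [hm] at h2 <;> omega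

/-- The reduction modulo five of the Euler product. -/
noncomputable def eulerMod : (ZMod 5)⟦X⟧ :=
  PowerSeries.map (Int.castRingHom (ZMod 5)) (PowerSeries.pentagonalSeries ℤ)

theorem coeff_eulerMod_cubed {n : ℕ} (h0 : n % 5 ≠ 0) (h1 : n % 5 ≠ 1) :
    PowerSeries.coeff n (eulerMod ^ 3) = 0 := by
  rw [eulerMod, ← map_pow, PowerSeries.coeff_map, eq_intCast]
  exact (ZMod.intCast_zmod_eq_zero_iff_dvd _ 5).2
    (mod_cast five_dvd_coeff_pentagonalSeries_cubed h0 h1)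

theorem coeff_expand_three_eulerMod {n : ℕ} (h : n % 5 = 2 ∨ n % 5 = 4) :
    PowerSeries.coeff n (PowerSeries.expand 3 three_ne_zero eulerMod) = 0 := by
  rw [PowerSeries.coeff_expand]
  split_ifs with h3
  · rw [eulerMod, PowerSeries.coeff_map, PowerSeries.coeff_pentagonalSeries_eq_zero, map_zero]
    rintro ⟨k, hk⟩
    have := pentagonal_mod_five k
    omega
  · rfl

theorem five_dvd_of_coeff_map_eq_zero {f : ℤ⟦X⟧} {n : ℕ}
    (h : PowerSeries.coeff n (PowerSeries.map (Int.castRingHom (ZMod 5)) f) = 0) :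
    5 ∣ PowerSeries.coeff n f := by
  rw [PowerSeries.coeff_map, eq_intCast] at h
  exact_mod_cast (ZMod.intCast_zmod_eq_zero_iff_dvd _ 5).1 h

theorem exists_eulerMod_mul_eq_one : ∃ g, eulerMod * g = 1 := by
  obtain ⟨g, hg⟩ := exists_pentagonalSeries_mul_eq_one
  exact ⟨_, by rw [eulerMod, ← map_mul, hg, map_one]⟩

theorem five_dvd_coeff_dissect_one (n : ℕ) :
    5 ∣ PowerSeries.coeff (5 * n + 2) (dissect 1 mockThetaBeta) := by
  apply five_dvd_of_coeff_map_eq_zero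
  have h := congr_arg (PowerSeries.map (Int.castRingHom (ZMod 5))) dissect_one_beta
  rw [map_mul, map_pow, map_pow, PowerSeries.map_expand] at h
  change _ * eulerMod ^ 2 = PowerSeries.expand 3 three_ne_zero eulerMod ^ 3 at h
  obtain ⟨g, hg⟩ := exists_eulerMod_mul_eq_one
  -- Rewrite 1/E² as E³/E⁵, so that the denominator becomes a series in q⁵.
  have e : PowerSeries.map (Int.castRingHom (ZMod 5)) (dissect 1 mockThetaBeta) =
      eulerMod ^ 3 * PowerSeries.expand 3 three_ne_zero (eulerMod ^ 3) *
        PowerSeries.expand 5 (by norm_num) g := by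
    rw [← pow_five_eq_expand, map_pow, ← h]
    have h5 : eulerMod ^ 5 * g ^ 5 = 1 := by rw [← mul_pow, hg, one_pow]
    linear_combination (-PowerSeries.map (Int.castRingHom (ZMod 5)) (dissect 1 mockThetaBeta)) * h5
  rw [e]
  refine coeff_mul_expand_five _ fun i hi => ?_
  rw [PowerSeries.coeff_mul]
  refine Finset.sum_eq_zero fun p hp => ?_
  rw [Finset.HasAntidiagonal.mem_antidiagonal] at hp
  -- E(q)³ allows the residues 0, 1 and E(q³)³ the residues 0, 3; no sum of the two is 2 mod 5.
  by_cases h01 : p.1 % 5 = 0 ∨ p.1 % 5 = 1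
  · rw [PowerSeries.coeff_expand]
    split_ifs with h3
    · rw [coeff_eulerMod_cubed (n := p.2 / 3) (by omega) (by omega), mul_zero]
    · rw [mul_zero]
  · rw [coeff_eulerMod_cubed (by omega) (by omega), zero_mul]

theorem five_dvd_coeff_dissect_five {n : ℕ} (hn : n % 5 = 2 ∨ n % 5 = 4) :
    5 ∣ PowerSeries.coeff n (dissect 1 (dissect 2 mockThetaBeta)) := by
  apply five_dvd_of_coeff_map_eq_zero
  have h := congr_arg (PowerSeries.map (Int.castRingHom (ZMod 5))) dissect_five_beta
  rw [map_mul, map_mul, map_pow, map_pow, PowerSeries.map_expand, map_ofNat] at h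
  change _ * eulerMod ^ 5 = 3 * PowerSeries.expand 3 three_ne_zero eulerMod ^ 6 at h
  obtain ⟨g, hg⟩ := exists_eulerMod_mul_eq_one
  have h5 : eulerMod ^ 5 * g ^ 5 = 1 := by rw [← mul_pow, hg, one_pow]
  set b := PowerSeries.map (Int.castRingHom (ZMod 5)) (dissect 1 (dissect 2 mockThetaBeta)) with hb
  have e : b = PowerSeries.expand 3 three_ne_zero eulerMod * PowerSeries.expand 5 (by norm_num)
        (3 * (PowerSeries.expand 3 three_ne_zero eulerMod * g)) := by
    rw [map_mul, ← pow_five_eq_expand (_ * g), map_ofNat]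
    linear_combination g ^ 5 * h - b * h5
  rw [e]
  exact coeff_mul_expand_five _ fun i hi => coeff_expand_three_eulerMod (by omega)

theorem three_dvd_coeff_dissect_five (n : ℕ) :
    3 ∣ PowerSeries.coeff n (dissect 1 (dissect 2 mockThetaBeta)) := by
  obtain ⟨g, hg⟩ := exists_pentagonalSeries_mul_eq_one
  have h5 : PowerSeries.pentagonalSeries ℤ ^ 5 * g ^ 5 = 1 := by rw [← mul_pow, hg, one_pow]
  have e : dissect 1 (dissect 2 mockThetaBeta) = PowerSeries.C (3 : ℤ) *
      (PowerSeries.expand 3 three_ne_zero (PowerSeries.pentagonalSeries ℤ) ^ 6 * g ^ 5) := by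
    rw [map_ofNat]
    linear_combination g ^ 5 * dissect_five_beta - dissect 1 (dissect 2 mockThetaBeta) * h5
  rw [e, PowerSeries.coeff_C_mul]
  exact dvd_mul_right _ _

theorem fifteen_dvd_coeff_dissect_five {n : ℕ} (hn : n % 5 = 2 ∨ n % 5 = 4) :
    15 ∣ pBeta (9 * n + 5) := by
  have h5 := five_dvd_coeff_dissect_five hn
  have h3 := three_dvd_coeff_dissect_five n
  rw [coeff_dissect, coeff_dissect, show 3 * (3 * n + 1) + 2 = 9 * n + 5 by ring] at h3 h5
  rw [pBeta]
  omega

end MockBeta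

theorem mainTheorem8 (n : ℕ) :
    pBeta (15 * n + 7) ≡ 0 [ZMOD 5] ∧
    pBeta (45 * n + 23) ≡ 0 [ZMOD 15] ∧
    pBeta (45 * n + 41) ≡ 0 [ZMOD 15] := by
  refine ⟨Int.modEq_zero_iff_dvd.2 ?_, Int.modEq_zero_iff_dvd.2 ?_, Int.modEq_zero_iff_dvd.2 ?_⟩
  · have h := MockBeta.five_dvd_coeff_dissect_one n
    rwa [MockBeta.coeff_dissect, show 3 * (5 * n + 2) + 1 = 15 * n + 7 by ring] at h
  · have h := MockBeta.fifteen_dvd_coeff_dissect_five (n := 5 * n + 2) (by omega)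
    rwa [show 9 * (5 * n + 2) + 5 = 45 * n + 23 by ring] at h
  · have h := MockBeta.fifteen_dvd_coeff_dissect_five (n := 5 * n + 4) (by omega)
    rwa [show 9 * (5 * n + 4) + 5 = 45 * n + 41 by ring] at h
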